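/- Let $X=\{X(t)\}_{t\ge 0}$ be a real Lévy process with Lévy density $p:\mathbb{R}\setminus\{0\}\to[0,\infty)$: $p$ is measurable with $\int_{\mathbb{R}\setminus\{0\}}(1\wedge x^2)\,p(x)\,dx<\infty$, $X$ has càdlàg paths (almost surely) and independent, stationary increments, and for some $b,\sigma\in\mathbb{R}$ and all $t\ge0$, $u\in\mathbb{R}$, $$\mathbb{E}\big[e^{iuX(t)}\big]=\exp\Big\{t\Big(iub-\frac{u^2\sigma^2}{2}+\int_{\mathbb{R}\setminus\{0\}}\big(e^{iux}-1-iux\,1_{\{|x|\le1\}}\big)p(x)\,dx\Big)\Big\}.$$ Let $\mathcal{J}(B)=\#\{t>0:\ \Delta X(t)\neq 0,\ (t,\Delta X(t))\in B\}$, with $\Delta X(t)=X(t)-X(t^-)$, be its jump measure on $[0,\infty)\times(\mathbb{R}\setminus\{0\})$. Let $D\subseteq\mathbb{R}\setminus\{0\}$ be a Borel set and $\eta$ a measure on the Borel subsets of $D$. Assume that on $D$ the Lévy measure $\nu(dx)=p(x)\,dx$ has a density $s=d\nu/d\eta$ with respect to $\eta$ which is nonnegative, bounded, and satisfies $\int_D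 s^2\,d\eta<\infty$. Write $\|f\|_\eta^2=\int_D f^2\,d\eta$. Let $T>0$, let $\mathcal{S}$ be a finite-dimensional subspace of $L^2(D,\eta)$, let $\varphi_1,\dots,\varphi_d$ be (functions on $D$ representing) an orthonormal basis of $\mathcal{S}$, and put $$s^\perp=\sum_{i=1}^d\Big(\int_D\varphi_i\,s\,d\eta\Big)\varphi_i,\qquad \hat s=\sum_{i=1}^d\hat\beta_i\,\varphi_i,\qquad \hat\beta_i=\frac1T\iint_{[0,T]\times D}\varphi_i(x)\,\mathcal{J}(dt,dx).$$ Then $s^\perp$ is the orthogonal projection of $s$ onto $\mathcal{S}$, the integrals defining $\hat\beta_i$ converge absolutely almost surely, and: 1. $\hat s$ is an unbiased estimator of $s^\perp$: for every $x\in D$, $\hat s(x)$ is integrable and $\mathbb{E}[\hat s(x)]=s^\perp(x)$. 2. The error $\chi^2=\|\hat s-s^\perp\|_\eta^2$ is integrable and $$\mathbb{E}[\chi^2]=\frac1T\sum_{i=1}^d\int_D\varphi_i^2(x)\,s(x)\,\eta(dx).$$ 3. The risk of $\hat s$ is finite and satisfies $$\mathbb{E}\big[\|s-\hat s\|_\eta^2\big]=\|s-s^\perp\|_\eta^2+\mathbb{E}[\chi^2].$$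 -/

import Mathlib

open MeasureTheory ProbabilityTheory Set Filter Topology
open scoped NNReal ENNReal

namespace LevyEstimation

/-- A path on `[0, ∞)` is càdlàg: right-continuous with left limits. -/
def IsCadlag (f : ℝ≥0 → ℝ) : Prop :=
  ∀ t, ContinuousWithinAt f (Ici t) t ∧ ∃ l, Tendsto f (𝓝[<] t) (𝓝 l)

/-- The jump `f(t) - f(t⁻)` of a path at time `t`. -/
noncomputable def jump (f : ℝ≥0 → ℝ) (t : ℝ≥0) : ℝ :=
  f t - Function.leftLim f t

/-- The measure on `[0, ∞) × ℝ` that puts a unit mass at `(t, jump f t)` for every time `t > 0`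
at which the path `f` jumps. -/
noncomputable def jumpMeasure (f : ℝ≥0 → ℝ) : Measure (ℝ≥0 × ℝ) :=
  Measure.sum fun t : {t : ℝ≥0 // 0 < t ∧ jump f t ≠ 0} =>
    Measure.dirac ((t : ℝ≥0), jump f t)

/-- The jump measure of a measurable set `B` is the number of times `t > 0` at which the path
jumps and `(t, jump f t)` lies in `B`. -/
theorem jumpMeasure_apply (f : ℝ≥0 → ℝ) {B : Set (ℝ≥0 × ℝ)} (hB : MeasurableSet B) :
    jumpMeasure f B =
      ({t : ℝ≥0 | 0 < t ∧ jump f t ≠ 0 ∧ (t, jump f t) ∈ B}.encard : ℝ≥0∞) := by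
  rw [jumpMeasure, Measure.sum_apply _ hB, ← ENNReal.tsum_set_one]
  simp only [Measure.dirac_apply' _ hB]
  refine (tsum_subtype {t : ℝ≥0 | 0 < t ∧ jump f t ≠ 0}
    (fun t => B.indicator (1 : ℝ≥0 × ℝ → ℝ≥0∞) (t, jump f t))).trans ?_
  rw [tsum_subtype {t : ℝ≥0 | 0 < t ∧ jump f t ≠ 0 ∧ (t, jump f t) ∈ B} (fun _ => (1 : ℝ≥0∞))]
  refine tsum_congr fun t => ?_
  by_cases h₁ : 0 < t ∧ jump f t ≠ 0 <;> by_cases h₂ : (t, jump f t) ∈ B <;>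
    simp_all

/-- `p` is a Lévy density on `ℝ \ {0}`: measurable, nonnegative and integrating `1 ∧ x²`. The value
`p 0` plays no role. -/
structure IsLevyDensity (p : ℝ → ℝ) : Prop where
  measurable : Measurable p
  nonneg : ∀ x, x ≠ 0 → 0 ≤ p x
  integrable : IntegrableOn (fun x => min 1 (x ^ 2) * p x) {0}ᶜ

/-- The Lévy measure `ν(dx) = p(x) dx` on `ℝ \ {0}`. -/
noncomputable def levyMeasure (p : ℝ → ℝ) : Measure ℝ :=
  (volume.restrict {0}ᶜ).withDensity fun x => ENNReal.ofReal (p x)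

/-- The Lévy-Khintchine exponent with drift `b`, Gaussian coefficient `σ` and Lévy density `p`. -/
noncomputable def levyExponent (b σ : ℝ) (p : ℝ → ℝ) (u : ℝ) : ℂ :=
  Complex.I * u * b - (u : ℂ) ^ 2 * (σ : ℂ) ^ 2 / 2 +
    ∫ x : ℝ in {0}ᶜ, (Complex.exp (Complex.I * u * x) - 1
      - Complex.I * u * x * (if |x| ≤ 1 then 1 else 0)) * (p x : ℂ)

/-- `X` is a real Lévy process with Lévy density `p`. That `X 0 = 0` almost surely is the case
`t = 0` of the formula for the characteristic function. -/
structure IsLevyProcess {Ω : Type*} [MeasurableSpace Ω] (P : Measure Ω) (X : ℝ≥0 → Ω → ℝ)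
    (p : ℝ → ℝ) : Prop where
  measurable : ∀ t, Measurable (X t)
  cadlag : ∀ᵐ ω ∂P, IsCadlag fun t => X t ω
  indep_increments : HasIndepIncrements X P
  stationary_increments :
    ∀ t h : ℝ≥0, IdentDistrib (fun ω => X (t + h) ω - X t ω) (fun ω => X h ω - X 0 ω) P P
  levyDensity : IsLevyDensity p
  characteristic : ∃ b σ : ℝ, ∀ (t : ℝ≥0) (u : ℝ),
    ∫ ω, Complex.exp (Complex.I * u * X t ω) ∂P = Complex.exp ((t : ℝ) * levyExponent b σ p u)

/-- On `D`, the Lévy measure `p(x) dx` has the density `s` with respect to the reference measure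
`η`, and `s` is nonnegative, bounded and square-integrable. Only the restriction of `η` to `D`
matters, so that `η` amounts to an arbitrary measure on the Borel sets of `D`. -/
structure HasReferenceDensity (p : ℝ → ℝ) (D : Set ℝ) (η : Measure ℝ) (s : ℝ → ℝ) : Prop where
  density : (levyMeasure p).restrict D = (η.restrict D).withDensity fun x => ENNReal.ofReal (s x)
  nonneg : ∀ᵐ x ∂η.restrict D, 0 ≤ s x
  bounded : ∃ C : ℝ, ∀ᵐ x ∂η.restrict D, s x ≤ C
  memLp : MemLp s 2 (η.restrict D)

/-- The functions `φ 0, …, φ (d - 1)` represent an orthonormal basis of the subspace `S` of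
`L²(D, η)`. -/
def IsOrthonormalBasisOf {D : Set ℝ} {η : Measure ℝ} {d : ℕ} (φ : Fin d → ℝ → ℝ)
    (S : Submodule ℝ (Lp ℝ 2 (η.restrict D))) : Prop :=
  ∃ e : OrthonormalBasis (Fin d) ℝ S,
    ∀ i, φ i =ᵐ[η.restrict D] ((e i : Lp ℝ 2 (η.restrict D)) : ℝ → ℝ)

/-- The squared norm of `L²(D, η)`. -/
noncomputable def normSq (D : Set ℝ) (η : Measure ℝ) (f : ℝ → ℝ) : ℝ :=
  ∫ x in D, f x ^ 2 ∂η

/-- The orthogonal projection `s^⊥ = ∑ i, ⟨φ i, s⟩ φ i` of `s`. -/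
noncomputable def projection (D : Set ℝ) (η : Measure ℝ) {d : ℕ} (φ : Fin d → ℝ → ℝ)
    (s : ℝ → ℝ) (x : ℝ) : ℝ :=
  ∑ i, (∫ y in D, φ i y * s y ∂η) * φ i x

/-- The coefficient `(1/T) ∬_{[0,T] × D} g(x) J(dt, dx)`, where `J` is the jump measure of the
path `f`. -/
noncomputable def empiricalCoeff (D : Set ℝ) (T : ℝ≥0) (g : ℝ → ℝ) (f : ℝ≥0 → ℝ) : ℝ :=
  (1 / (T : ℝ)) * ∫ z in Icc 0 T ×ˢ D, g z.2 ∂jumpMeasure f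

/-- The projection estimator computed from the path `f` on `[0, T]`. -/
noncomputable def projectionEstimator (D : Set ℝ) (T : ℝ≥0) {d : ℕ} (φ : Fin d → ℝ → ℝ)
    (f : ℝ≥0 → ℝ) (x : ℝ) : ℝ :=
  ∑ i, empiricalCoeff D T (φ i) f * φ i x

/-- The error `χ² = ‖ŝ - s^⊥‖²` for the path `f`. -/
noncomputable def chiSq (D : Set ℝ) (η : Measure ℝ) (T : ℝ≥0) {d : ℕ} (φ : Fin d → ℝ → ℝ)
    (s : ℝ → ℝ) (f : ℝ≥0 → ℝ) : ℝ :=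
  normSq D η fun x => projectionEstimator D T φ f x - projection D η φ s x

end LevyEstimation

open LevyEstimation

/-! Everything rests on two moments. For `g` integrable and square-integrable on `D` with respect to
the Lévy measure `ν`, the integral of `g` over the jumps in `[0,T] × D` has mean `T ∫ g dν` and
second moment `T ∫ g² dν + (T ∫ g dν)²` (`IsLevyProcess.moments_integral_jumpMeasure`). Hence each
empirical coefficient has mean `⟨φ i, s⟩` and variance `T⁻¹ ∫ φ i² s dη`. Orthonormality turns `χ²`
into the sum of the squared coefficient errors, and since `s - s^⊥` is orthogonal to the span of the
`φ i`, the loss splits path by path.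

The moment formulas are obtained without the Lévy-Itô decomposition and without showing that the
jump measure is Poisson. Let `g ≥ 0` be bounded, continuous and zero near the origin. On a càdlàg
path, the sum of `g` over the increments along the grid of mesh `T/n` converges to the sum of `g`
over the jumps (`IsCadlag.tendsto_incrementSum_lintegral`). The increments are i.i.d., so this sum
has mean `n E g(X(T/n))`, which tends to `T ∫ g dν` (`tendsto_nat_mul_integral`). Independence gives
the second moments in the same way, and exponential moments bounded uniformly in `n` allow the limit
to be taken under the expectation.

The small-time limit comes from characteristic functions. Put `w(x) = 1 - exp(-x²/2)` and let `V` be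
standard Gaussian. The characteristic function of `w μ` at `u` is the mean over `V` of `μ̂(u) - μ̂(u
+ V)`. For `n` times the law of `X(T/n)` it tends to `T E[ψ(u) - ψ(u + V)]`, with `ψ` the
Lévy-Khintchine exponent. This is `T` times the characteristic function of `(σ²/2) δ₀ + w ν`: the
drift averages out. Lévy's continuity theorem gives weak convergence, which is tested against `g /
w`; this function vanishes at `0` and so ignores the Gaussian atom.

The formulas then pass from test functions to measurable functions as identities of measures not
charging `0`. This needs a measurable version of the random measure of jump sizes
(`IsLevyProcess.exists_jumpKernel`); the second order identity is extended one variable at a time.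
-/

namespace LevyEstimation

/-! ### Jumps of a càdlàg path as limits of grid increments. -/

/-- The point `k T / n` of the regular grid of `[0, T]`. -/
noncomputable def gridTime (T : ℝ≥0) (n k : ℕ) : ℝ≥0 := k * T / n

/-- The sum of `g` over the increments of `f` along the regular grid of `[0, T]`. -/
noncomputable def incrementSum (g : ℝ → ℝ) (T : ℝ≥0) (f : ℝ≥0 → ℝ) (n : ℕ) : ℝ :=
  ∑ k ∈ Finset.range n, g (f (gridTime T n (k + 1)) - f (gridTime T n k))

/-- The measure counting the jump sizes of `f` on `[0, T]`. -/
noncomputable def jumpSizes (T : ℝ≥0) (f : ℝ≥0 → ℝ) : Measure ℝ :=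
  ((jumpMeasure f).restrict (Icc 0 T ×ˢ univ)).map Prod.snd

/-- Near `t`, values at or to the right of `t` are within `δ/2` of `f t`, and values to the left are
within `δ/2` of the left limit. An increment therefore stays on one side and is small, or crosses
`t` and is close to the jump. This is the only form in which the càdlàg property is used to control
increments. -/
theorem IsCadlag.exists_nhds_increment {f : ℝ≥0 → ℝ} (hf : IsCadlag f) (t : ℝ≥0) {δ : ℝ}
    (hδ : 0 < δ) :
    ∃ U ∈ 𝓝 t, ∀ a ∈ U, ∀ b ∈ U, a ≤ b →
      (t ∉ Ioc a b → |f b - f a| < δ) ∧ (t ∈ Ioc a b → |f b - f a - jump f t| < δ) := by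
  have h1 := (hf t).1.eventually (Metric.ball_mem_nhds (f t) (half_pos hδ))
  have h2 := (tendsto_leftLim_of_tendsto (hf t).2).eventually
    (Metric.ball_mem_nhds _ (half_pos hδ))
  rw [eventually_nhdsWithin_iff] at h1 h2
  refine ⟨_, h1.and h2, ?_⟩
  rintro a ⟨ha1, ha2⟩ b ⟨hb1, hb2⟩ hab
  simp only [Real.dist_eq, mem_Ici, mem_Iio, abs_lt] at ha1 ha2 hb1 hb2
  simp only [mem_Ioc, not_and_or, not_lt, not_le, abs_lt, jump]
  constructor
  · rintro (h | h)
    · have := ha1 h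
      have := hb1 (h.trans hab)
      constructor <;> linarith
    · have := ha2 (hab.trans_lt h)
      have := hb2 h
      constructor <;> linarith
  · rintro ⟨h, h'⟩
    have := ha2 h
    have := hb1 h'
    constructor <;> linarith

theorem jump_zero (f : ℝ≥0 → ℝ) : jump f 0 = 0 := by
  rw [jump, leftLim_eq_of_isBot (fun _ => zero_le), sub_self]

theorem IsCadlag.finite_jumps {f : ℝ≥0 → ℝ} (hf : IsCadlag f) (T : ℝ≥0) {δ : ℝ} (hδ : 0 < δ) :
    {t | t ≤ T ∧ δ ≤ |jump f t|}.Finite := by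
  have key : (Icc 0 T ∩ {t | δ ≤ |jump f t|}).Finite := by
    refine (isCompact_Icc (a := (0 : ℝ≥0)) (b := T)).induction_on
      (p := fun s => (s ∩ {t | δ ≤ |jump f t|}).Finite) (by simp)
      (fun s t hst ht => ht.subset (inter_subset_inter_left _ hst))
      (fun s t hs ht => by rw [union_inter_distrib_right]; exact hs.union ht) ?_
    intro t _
    obtain ⟨U, hU, h⟩ := hf.exists_nhds_increment t (half_pos hδ)
    obtain ⟨V, hVU, hV, htV⟩ := mem_nhds_iff.1 hU
    refine ⟨V, mem_nhdsWithin_of_mem_nhds (hV.mem_nhds htV), (finite_singleton t).subset ?_⟩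
    rintro r ⟨hrV, hr⟩
    by_contra hrt
    rw [mem_singleton_iff] at hrt
    have hr0 : r ≠ 0 := by
      rintro rfl
      simp only [jump_zero, abs_zero, mem_ofPred_eq] at hr
      linarith
    have hr0' : 0 < r := pos_iff_ne_zero.2 hr0
    -- The jump at `r ≠ t` is the limit of the increments from `a` to `r` as `a` increases to `r`.
    -- These eventually lie in `V` and do not cross `t`, so they are smaller than `δ/2`.
    have hne : (𝓝[<] r).NeBot := nhdsLT_neBot_of_exists_lt ⟨0, hr0'⟩
    have hlim : Tendsto (fun a => |f r - f a|) (𝓝[<] r) (𝓝 |jump f r|) :=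
      (tendsto_const_nhds.sub (tendsto_leftLim_of_tendsto (hf r).2)).abs
    have hle : |jump f r| ≤ δ / 2 := by
      refine le_of_tendsto hlim ?_
      have hev : ∀ᶠ a in 𝓝[<] r, t ∉ Ioc a r := by
        rcases lt_or_gt_of_ne hrt with h' | h'
        · exact Eventually.of_forall fun a ha => absurd ha.2 (not_le.2 h')
        · filter_upwards [mem_nhdsWithin_of_mem_nhds (lt_mem_nhds h')] with a ha ha'
          exact absurd ha'.1 (not_lt.2 (le_of_lt ha))
      filter_upwards [hev, self_mem_nhdsWithin, mem_nhdsWithin_of_mem_nhds (hV.mem_nhds hrV)]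
        with a h1 h2 h3
      exact ((h a (hVU h3) r (hVU hrV) (le_of_lt h2)).1 h1).le
    have : δ ≤ |jump f r| := hr
    linarith
  exact key.subset fun t ht => ⟨⟨zero_le, ht.1⟩, ht.2⟩

theorem gridTime_mono (T : ℝ≥0) (n : ℕ) : Monotone (gridTime T n) := by
  intro a b hab
  unfold gridTime
  gcongr

theorem gridTime_succ (T : ℝ≥0) (n k : ℕ) : gridTime T n (k + 1) = gridTime T n k + T / n := by
  simp only [gridTime, Nat.cast_add, Nat.cast_one]
  ring

theorem gridTime_le {T : ℝ≥0} {n k : ℕ} (hk : k ≤ n) : gridTime T n k ≤ T := by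
  rcases Nat.eq_zero_or_pos n with rfl | hn
  · simp [gridTime]
  · have hn' : (0 : ℝ≥0) < n := by exact_mod_cast hn
    rw [gridTime, div_le_iff₀ hn', mul_comm]
    gcongr

/-- The index of the grid interval `(kT/n, (k+1)T/n]` that contains `t`. -/
noncomputable def gridIndex (T : ℝ≥0) (n : ℕ) (t : ℝ≥0) : ℕ := ⌈t * n / T⌉₊ - 1

theorem mem_Ioc_gridIndex {T t : ℝ≥0} {n : ℕ} (hn : 0 < n) (ht : 0 < t) (htT : t ≤ T) :
    gridIndex T n t < n ∧
      t ∈ Ioc (gridTime T n (gridIndex T n t)) (gridTime T n (gridIndex T n t + 1)) := by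
  have hT : 0 < T := ht.trans_le htT
  have hn' : (0 : ℝ≥0) < n := by exact_mod_cast hn
  -- Since `t > 0`, the truncated subtraction in `gridIndex` is a true one.
  have hpos : 0 < ⌈t * n / T⌉₊ := Nat.ceil_pos.2 (by positivity)
  have hle : ⌈t * n / T⌉₊ ≤ n := by
    rw [Nat.ceil_le, div_le_iff₀ hT, mul_comm]
    gcongr
  have hsucc : gridIndex T n t + 1 = ⌈t * n / T⌉₊ := by unfold gridIndex; omega
  refine ⟨by omega, ?_, ?_⟩
  · have h : gridIndex T n t < ⌈t * n / T⌉₊ := by omega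
    rw [Nat.lt_ceil, lt_div_iff₀ hT] at h
    rw [gridTime, div_lt_iff₀ hn']
    exact h
  · rw [hsucc, gridTime, le_div_iff₀ hn', ← div_le_iff₀ hT]
    exact Nat.le_ceil _

theorem eq_gridIndex_of_mem_Ioc {T t : ℝ≥0} {n k : ℕ} (hn : 0 < n) (ht : 0 < t) (htT : t ≤ T)
    (hk : t ∈ Ioc (gridTime T n k) (gridTime T n (k + 1))) : k = gridIndex T n t := by
  obtain ⟨_, h1, h2⟩ := mem_Ioc_gridIndex hn ht htT
  rcases lt_trichotomy k (gridIndex T n t) with h | h | h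
  · exact absurd (hk.2.trans (gridTime_mono T n h)) (not_le.2 h1)
  · exact h
  · exact absurd (h2.trans (gridTime_mono T n h)) (not_le.2 hk.1)

theorem tendsto_mesh (T : ℝ≥0) : Tendsto (fun n : ℕ => T / (n : ℝ≥0)) atTop (𝓝 0) :=
  tendsto_const_div_atTop_nhds_zero_nat (𝕜 := ℝ≥0) T

theorem dist_lt_of_mem_Icc_gridTime {T t a : ℝ≥0} {n k : ℕ} {r : ℝ} (hr : ((T / n : ℝ≥0) : ℝ) < r)
    (ht : t ∈ Icc (gridTime T n k) (gridTime T n (k + 1)))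
    (ha : a ∈ Icc (gridTime T n k) (gridTime T n (k + 1))) : dist a t < r := by
  rw [gridTime_succ] at ht ha
  have h1 : (gridTime T n k : ℝ) ≤ t := ht.1
  have h2 : (t : ℝ) ≤ gridTime T n k + (T / n : ℝ≥0) := by exact_mod_cast ht.2
  have h3 : (gridTime T n k : ℝ) ≤ a := ha.1
  have h4 : (a : ℝ) ≤ gridTime T n k + (T / n : ℝ≥0) := by exact_mod_cast ha.2
  rw [NNReal.dist_eq, abs_lt]
  constructor <;> linarith

theorem eventually_mesh_lt (T : ℝ≥0) {r : ℝ} (hr : 0 < r) :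
    ∀ᶠ n : ℕ in atTop, ((T / n : ℝ≥0) : ℝ) < r := by
  have h := NNReal.tendsto_coe.2 (tendsto_mesh T)
  exact h.eventually (gt_mem_nhds (by simpa using hr))

theorem IsCadlag.tendsto_increment_gridIndex {f : ℝ≥0 → ℝ} (hf : IsCadlag f) {T t : ℝ≥0}
    (ht : 0 < t) (htT : t ≤ T) :
    Tendsto (fun n => f (gridTime T n (gridIndex T n t + 1)) - f (gridTime T n (gridIndex T n t)))
      atTop (𝓝 (jump f t)) := by
  rw [Metric.tendsto_nhds]
  intro δ hδ
  obtain ⟨U, hU, h⟩ := hf.exists_nhds_increment t hδ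
  obtain ⟨r, hr, hrU⟩ := Metric.mem_nhds_iff.1 hU
  filter_upwards [eventually_mesh_lt T hr, eventually_gt_atTop 0] with n hn hn0
  obtain ⟨_, hmem⟩ := mem_Ioc_gridIndex hn0 ht htT
  have hle := gridTime_mono T n (Nat.le_succ (gridIndex T n t))
  rw [Real.dist_eq]
  refine (h _ (hrU ?_) _ (hrU ?_) hle).2 hmem
  · exact dist_lt_of_mem_Icc_gridTime hn (Ioc_subset_Icc_self hmem) (left_mem_Icc.2 hle)
  · exact dist_lt_of_mem_Icc_gridTime hn (Ioc_subset_Icc_self hmem) (right_mem_Icc.2 hle)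

/-- A Lebesgue number for the local neighbourhoods makes the estimate uniform over the cells: once
the mesh is below it, each cell lies in the neighbourhood of one time `t`, and its increment is
within `ε/2` of either zero or the jump at `t`. -/
theorem IsCadlag.eventually_increment_lt {f : ℝ≥0 → ℝ} (hf : IsCadlag f) (T : ℝ≥0) {ε : ℝ}
    (hε : 0 < ε) :
    ∀ᶠ n in atTop, ∀ k < n,
      (∀ t ∈ Ioc (gridTime T n k) (gridTime T n (k + 1)), |jump f t| < ε / 2) →
        |f (gridTime T n (k + 1)) - f (gridTime T n k)| < ε := by
  choose U hU h using fun t => hf.exists_nhds_increment t (half_pos hε)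
  obtain ⟨r, hr, hleb⟩ := lebesgue_number_lemma_of_metric (isCompact_Icc (a := (0 : ℝ≥0)) (b := T))
    (c := fun t => interior (U t)) (fun _ => isOpen_interior)
    (fun t _ => mem_iUnion.2 ⟨t, mem_interior_iff_mem_nhds.2 (hU t)⟩)
  filter_upwards [eventually_mesh_lt T hr] with n hn k hk hsmall
  have hle := gridTime_mono T n (Nat.le_succ k)
  obtain ⟨t, ht⟩ := hleb (gridTime T n k) ⟨zero_le, gridTime_le hk.le⟩
  have hsub : ∀ a ∈ Icc (gridTime T n k) (gridTime T n (k + 1)), a ∈ U t := fun a ha =>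
    interior_subset (ht (dist_lt_of_mem_Icc_gridTime hn (left_mem_Icc.2 hle) ha))
  have hinc := h t _ (hsub _ (left_mem_Icc.2 hle)) _ (hsub _ (right_mem_Icc.2 hle)) hle
  by_cases hmem : t ∈ Ioc (gridTime T n k) (gridTime T n (k + 1))
  · have h1 := hinc.2 hmem
    have h2 := hsmall t hmem
    rw [abs_lt] at h1 h2 ⊢
    constructor <;> linarith
  · linarith [hinc.1 hmem]

/-- On a fine grid, the finitely many jumps of size at least `ε/2` occupy distinct cells, whose
increments converge to those jumps. Every other cell has an increment below `ε`, where `g` vanishes.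
The threshold `ε/2` leaves room for the oscillation outside the jumps. -/
theorem IsCadlag.tendsto_incrementSum {f : ℝ≥0 → ℝ} (hf : IsCadlag f) (T : ℝ≥0) {g : ℝ → ℝ}
    (hg : Continuous g) {ε : ℝ} (hε : 0 < ε) (hgε : ∀ x, |x| < ε → g x = 0) {F : Finset ℝ≥0}
    (hF : ∀ t, t ∈ F ↔ t ≤ T ∧ ε / 2 ≤ |jump f t|) :
    Tendsto (incrementSum g T f) atTop (𝓝 (∑ t ∈ F, g (jump f t))) := by
  have hFpos : ∀ t ∈ F, 0 < t := fun t ht => by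
    refine pos_iff_ne_zero.2 ?_
    rintro rfl
    have := ((hF 0).1 ht).2
    rw [jump_zero, abs_zero] at this
    linarith
  have hlim : Tendsto (fun n => ∑ t ∈ F,
      g (f (gridTime T n (gridIndex T n t + 1)) - f (gridTime T n (gridIndex T n t))))
      atTop (𝓝 (∑ t ∈ F, g (jump f t))) :=
    tendsto_finsetSum _ fun t ht => (hg.tendsto _).comp
      (hf.tendsto_increment_gridIndex (hFpos t ht) ((hF t).1 ht).1)
  refine hlim.congr' ?_
  -- Two distinct times cannot share a cell once the mesh is below their distance.
  have hinj : ∀ᶠ n in atTop, Set.InjOn (gridIndex T n) F := by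
    have h : ∀ᶠ n in atTop, ∀ t ∈ F, ∀ t' ∈ F, gridIndex T n t = gridIndex T n t' → t = t' := by
      refine (eventually_all_finset _).2 fun t ht => (eventually_all_finset _).2 fun t' ht' => ?_
      by_cases htt : t = t'
      · exact Eventually.of_forall fun _ _ => htt
      filter_upwards [eventually_mesh_lt T (dist_pos.2 htt), eventually_gt_atTop 0] with n hn hn0 he
      have h1 := (mem_Ioc_gridIndex hn0 (hFpos t ht) ((hF t).1 ht).1).2
      have h2 := (mem_Ioc_gridIndex hn0 (hFpos t' ht') ((hF t').1 ht').1).2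
      rw [← he] at h2
      exact absurd (dist_lt_of_mem_Icc_gridTime hn (Ioc_subset_Icc_self h2)
        (Ioc_subset_Icc_self h1)) (lt_irrefl _)
    filter_upwards [h] with n hn t ht t' ht' he using hn t ht t' ht' he
  filter_upwards [hinj, hf.eventually_increment_lt T hε, eventually_gt_atTop 0]
    with n hn hsmall hn0
  rw [incrementSum, ← Finset.sum_image (s := F) (g := gridIndex T n)
    (f := fun k => g (f (gridTime T n (k + 1)) - f (gridTime T n k))) hn]
  refine Finset.sum_subset ?_ ?_
  · intro k hk
    obtain ⟨t, ht, rfl⟩ := Finset.mem_image.1 hk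
    exact Finset.mem_range.2 (mem_Ioc_gridIndex hn0 (hFpos t ht) ((hF t).1 ht).1).1
  · intro k hk hkF
    refine hgε _ (hsmall k (Finset.mem_range.1 hk) fun t ht => ?_)
    by_contra hlt
    have htT : t ≤ T := ht.2.trans (gridTime_le (Finset.mem_range.1 hk))
    have htF : t ∈ F := (hF t).2 ⟨htT, not_lt.1 hlt⟩
    exact hkF (Finset.mem_image.2 ⟨t, htF, (eq_gridIndex_of_mem_Ioc hn0 (hFpos t htF) htT ht).symm⟩)

theorem lintegral_jumpSizes (T : ℝ≥0) (f : ℝ≥0 → ℝ) {g : ℝ → ℝ≥0∞} (hg : Measurable g) :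
    ∫⁻ x, g x ∂jumpSizes T f =
      ∑' t : {t : ℝ≥0 // 0 < t ∧ jump f t ≠ 0}, (Iic T).indicator (fun t => g (jump f t)) t := by
  have hm : MeasurableSet (Icc 0 T ×ˢ (univ : Set ℝ)) := measurableSet_Icc.prod .univ
  rw [jumpSizes, lintegral_map hg measurable_snd, ← lintegral_indicator hm, jumpMeasure,
    lintegral_sum_measure]
  refine tsum_congr fun t => ?_
  rw [lintegral_dirac]
  by_cases h : (t : ℝ≥0) ≤ T <;> simp [h]

theorem IsCadlag.lintegral_jumpSizes_eq_sum {f : ℝ≥0 → ℝ} {T : ℝ≥0} {g : ℝ → ℝ≥0∞}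
    (hg : Measurable g) {ε : ℝ} (hε : 0 < ε) (hgε : ∀ x, |x| < ε → g x = 0) {F : Finset ℝ≥0}
    (hF : ∀ t, t ∈ F ↔ t ≤ T ∧ ε / 2 ≤ |jump f t|) :
    ∫⁻ x, g x ∂jumpSizes T f = ∑ t ∈ F, g (jump f t) := by
  rw [lintegral_jumpSizes T f hg]
  refine (tsum_subtype {t : ℝ≥0 | 0 < t ∧ jump f t ≠ 0}
    ((Iic T).indicator (fun t => g (jump f t)))).trans ?_
  rw [tsum_eq_sum (s := F)]
  · refine Finset.sum_congr rfl fun t ht => ?_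
    obtain ⟨h1, h2⟩ := (hF t).1 ht
    have h3 : jump f t ≠ 0 := fun h => by rw [h, abs_zero] at h2; linarith
    have h4 : 0 < t := pos_iff_ne_zero.2 fun h => h3 (h ▸ jump_zero f)
    rw [indicator_of_mem (show t ∈ {t : ℝ≥0 | 0 < t ∧ jump f t ≠ 0} from ⟨h4, h3⟩),
      indicator_of_mem (show t ∈ Iic T from h1)]
  · intro t ht
    by_cases h1 : t ≤ T
    · have : g (jump f t) = 0 := hgε _ (by
        by_contra h
        exact ht ((hF t).2 ⟨h1, by linarith⟩))
      simp [indicator, this]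
    · simp [indicator, h1]

/-- The increment sums of `g` converge to the integral of `g` against the jump sizes. -/
theorem IsCadlag.tendsto_incrementSum_lintegral {f : ℝ≥0 → ℝ} (hf : IsCadlag f) (T : ℝ≥0)
    {g : ℝ → ℝ} (hg : Continuous g) (hg0 : ∀ x, 0 ≤ g x) {ε : ℝ} (hε : 0 < ε)
    (hgε : ∀ x, |x| < ε → g x = 0) :
    ∫⁻ x, ENNReal.ofReal (g x) ∂jumpSizes T f ≠ ∞ ∧
    Tendsto (incrementSum g T f) atTop
      (𝓝 (∫⁻ x, ENNReal.ofReal (g x) ∂jumpSizes T f).toReal) := by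
  have hF : ∀ t, t ∈ (hf.finite_jumps T (half_pos hε)).toFinset ↔
      t ≤ T ∧ ε / 2 ≤ |jump f t| := fun t => by simp
  rw [IsCadlag.lintegral_jumpSizes_eq_sum (by fun_prop) hε (fun x hx => by simp [hgε x hx]) hF]
  refine ⟨by simp, ?_⟩
  rw [← ENNReal.ofReal_sum_of_nonneg fun _ _ => hg0 _,
    ENNReal.toReal_ofReal (Finset.sum_nonneg fun _ _ => hg0 _)]
  exact hf.tendsto_incrementSum T hg hε hgε hF

/-! ### Weak convergence of finite measures, and integration against densities. -/

section Weak

/-- Lévy's convergence theorem for finite measures. -/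
theorem tendsto_integral_of_tendsto_charFun {ρ : ℕ → Measure ℝ} {ρ₀ : Measure ℝ}
    [∀ n, IsFiniteMeasure (ρ n)] [IsFiniteMeasure ρ₀]
    (h : ∀ t, Tendsto (fun n => charFun (ρ n) t) atTop (𝓝 (charFun ρ₀ t)))
    (f : BoundedContinuousFunction ℝ ℝ) :
    Tendsto (fun n => ∫ x, f x ∂ρ n) atTop (𝓝 (∫ x, f x ∂ρ₀)) := by
  let m : ℕ → FiniteMeasure ℝ := fun n => ⟨ρ n, inferInstance⟩
  let m₀ : FiniteMeasure ℝ := ⟨ρ₀, inferInstance⟩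
  have hmass : Tendsto (fun n => (m n).mass) atTop (𝓝 m₀.mass) := by
    have h0 := h 0
    simp only [charFun_zero] at h0
    have h1 := (Complex.continuous_re.tendsto _).comp h0
    rw [← NNReal.tendsto_coe]
    exact h1
  suffices hm : Tendsto m atTop (𝓝 m₀) from
    FiniteMeasure.tendsto_iff_forall_integral_tendsto.1 hm f
  -- The proof normalizes to probability measures, which has no meaning for a zero limit; in that
  -- case convergence of the masses is enough.
  by_cases h0 : m₀ = 0
  · rw [h0] at hmass ⊢
    exact FiniteMeasure.tendsto_zero_of_tendsto_zero_mass (by simpa using hmass)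
  refine FiniteMeasure.tendsto_of_tendsto_normalize_testAgainstNN_of_tendsto_mass ?_ hmass
  rw [ProbabilityMeasure.tendsto_iff_tendsto_charFun]
  have hne : ∀ᶠ n in atTop, m n ≠ 0 := by
    simp_rw [← FiniteMeasure.mass_nonzero_iff]
    exact hmass.eventually_ne ((FiniteMeasure.mass_nonzero_iff _).2 h0)
  have hform : ∀ (μ : FiniteMeasure ℝ) (_ : μ ≠ 0) (t : ℝ),
      charFun (μ.normalize : Measure ℝ) t = ((μ.mass : ℝ) : ℂ)⁻¹ * charFun (μ : Measure ℝ) t := by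
    intro μ hμ t
    rw [μ.toMeasure_normalize_eq_of_nonzero hμ, charFun_apply, charFun_apply,
      integral_smul_nnreal_measure, NNReal.smul_def, Complex.real_smul]
    simp
  intro t
  rw [hform m₀ h0]
  refine Tendsto.congr' (f₁ := fun n => (((m n).mass : ℝ) : ℂ)⁻¹ * charFun (m n : Measure ℝ) t) ?_ ?_
  · filter_upwards [hne] with n hn using (hform _ hn t).symm
  · refine Tendsto.mul (Tendsto.inv₀ ?_ ?_) (h t)
    · exact (Complex.continuous_ofReal.tendsto _).comp (NNReal.tendsto_coe.2 hmass)
    · have := (FiniteMeasure.mass_nonzero_iff _).2 h0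
      exact_mod_cast this

theorem integral_withDensity_ofReal {α E : Type*} [MeasurableSpace α] [NormedAddCommGroup E]
    [NormedSpace ℝ E] {μ : Measure α} {w : α → ℝ} (hw : AEMeasurable w μ)
    (hw0 : ∀ᵐ x ∂μ, 0 ≤ w x) (f : α → E) :
    ∫ x, f x ∂μ.withDensity (fun x => ENNReal.ofReal (w x)) = ∫ x, w x • f x ∂μ := by
  rw [integral_withDensity_eq_integral_toReal_smul₀ hw.ennreal_ofReal
    (Eventually.of_forall fun _ => ENNReal.ofReal_lt_top)]
  refine integral_congr_ae ?_
  filter_upwards [hw0] with x hx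
  rw [ENNReal.toReal_ofReal hx]

theorem integrable_withDensity_ofReal_iff {α E : Type*} [MeasurableSpace α] [NormedAddCommGroup E]
    [NormedSpace ℝ E] {μ : Measure α} {w : α → ℝ} (hw : AEMeasurable w μ)
    (hw0 : ∀ᵐ x ∂μ, 0 ≤ w x) {f : α → E} :
    Integrable f (μ.withDensity (fun x => ENNReal.ofReal (w x))) ↔
      Integrable (fun x => w x • f x) μ := by
  rw [integrable_withDensity_iff_integrable_smul₀' hw.ennreal_ofReal
    (Eventually.of_forall fun _ => ENNReal.ofReal_lt_top)]
  refine integrable_congr ?_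
  filter_upwards [hw0] with x hx
  rw [ENNReal.toReal_ofReal hx]

end Weak

/-! ### Bounds on the Lévy-Khintchine exponent. -/

section Exponent

/-- The integrand of the Lévy-Khintchine formula. -/
noncomputable def levyKernel (u x : ℝ) : ℂ :=
  Complex.exp (Complex.I * u * x) - 1 - Complex.I * u * x * (if |x| ≤ 1 then 1 else 0)

theorem norm_exp_I_mul_mul (u x : ℝ) : ‖Complex.exp (Complex.I * u * x)‖ = 1 := by
  rw [mul_assoc, ← Complex.ofReal_mul, Complex.norm_exp_I_mul_ofReal]

/-- For `|x| ≤ 1` the compensator leaves a second order Taylor remainder when `|u x| ≤ 1`; otherwise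
`|u x| ≤ (u x)²` absorbs the trivial bound. The quadratic growth in `u` is what later makes Gaussian
averaging over `u` legitimate. -/
theorem norm_levyKernel_le (u x : ℝ) : ‖levyKernel u x‖ ≤ 3 * (1 + u ^ 2) * min 1 (x ^ 2) := by
  have h2 : ‖Complex.exp (Complex.I * u * x) - 1‖ ≤ 2 := by
    refine (norm_sub_le _ _).trans ?_
    rw [norm_exp_I_mul_mul, norm_one]
    norm_num
  have hn : ‖Complex.I * u * x‖ = |u * x| := by
    simp [abs_mul]
  rcases le_or_gt |x| 1 with hx | hx
  · have hx2 : x ^ 2 ≤ 1 := by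
      rw [← sq_abs]
      exact pow_le_one₀ (abs_nonneg _) hx
    rw [min_eq_right hx2]
    simp only [levyKernel, hx, if_true, mul_one]
    rcases le_or_gt |u * x| 1 with hux | hux
    · have := Complex.norm_exp_sub_one_sub_id_le (hn.trans_le hux)
      rw [hn, sq_abs] at this
      nlinarith [sq_nonneg (u * x), sq_nonneg x]
    · have h3 := (norm_sub_le (Complex.exp (Complex.I * u * x) - 1) (Complex.I * u * x))
      rw [hn] at h3
      have h4 : |u * x| ≤ |u * x| ^ 2 := by nlinarith
      rw [sq_abs] at h4
      nlinarith [sq_nonneg (u * x), sq_nonneg x]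
  · have hx2 : 1 ≤ x ^ 2 := by
      rw [← sq_abs]
      exact one_le_pow₀ hx.le
    rw [min_eq_left hx2]
    simp only [levyKernel, not_le.2 hx, if_false, mul_zero, sub_zero]
    nlinarith [sq_nonneg u]

theorem measurable_levyKernel {α : Type*} [MeasurableSpace α] {f g : α → ℝ} (hf : Measurable f)
    (hg : Measurable g) : Measurable fun a => levyKernel (f a) (g a) := by
  unfold levyKernel
  refine Measurable.sub (by fun_prop) (Measurable.mul (by fun_prop) (Measurable.ite ?_ ?_ ?_))
  · exact measurableSet_le (by fun_prop) measurable_const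
  · exact measurable_const
  · exact measurable_const

variable {p : ℝ → ℝ}

theorem IsLevyDensity.ae_nonneg (hp : IsLevyDensity p) :
    ∀ᵐ x ∂(volume.restrict ({0}ᶜ : Set ℝ)), 0 ≤ p x := by
  filter_upwards [ae_restrict_mem (measurableSet_singleton (0 : ℝ)).compl] with x hx
  exact hp.nonneg x hx

theorem IsLevyDensity.integral_levyMeasure (hp : IsLevyDensity p) {E : Type*}
    [NormedAddCommGroup E] [NormedSpace ℝ E] (f : ℝ → E) :
    ∫ x, f x ∂levyMeasure p = ∫ x in {0}ᶜ, p x • f x :=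
  integral_withDensity_ofReal hp.measurable.aemeasurable hp.ae_nonneg f

theorem IsLevyDensity.integrable_min (hp : IsLevyDensity p) :
    Integrable (fun x => min 1 (x ^ 2)) (levyMeasure p) := by
  rw [levyMeasure, integrable_withDensity_ofReal_iff hp.measurable.aemeasurable hp.ae_nonneg]
  simpa only [smul_eq_mul, mul_comm, IntegrableOn] using hp.integrable

instance sigmaFinite_levyMeasure : SigmaFinite (levyMeasure p) := by
  unfold levyMeasure
  infer_instance

theorem levyMeasure_zero : levyMeasure p {0} = 0 := by
  refine withDensity_absolutelyContinuous _ _ ?_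
  rw [Measure.restrict_apply (measurableSet_singleton 0)]
  simp

theorem IsLevyDensity.integrable_of_norm_le (hp : IsLevyDensity p) {E : Type*}
    [NormedAddCommGroup E] {f : ℝ → E} (hf : AEStronglyMeasurable f (levyMeasure p)) (C : ℝ)
    (h : ∀ x, ‖f x‖ ≤ C * min 1 (x ^ 2)) : Integrable f (levyMeasure p) :=
  (hp.integrable_min.const_mul C).mono' hf (Eventually.of_forall h)

theorem IsLevyDensity.integrable_levyKernel (hp : IsLevyDensity p) (u : ℝ) :
    Integrable (levyKernel u) (levyMeasure p) :=
  hp.integrable_of_norm_le (measurable_levyKernel measurable_const measurable_id).aestronglyMeasurable _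
    (norm_levyKernel_le u)

theorem IsLevyDensity.levyExponent_eq (hp : IsLevyDensity p) (b σ u : ℝ) :
    levyExponent b σ p u = Complex.I * u * b - (u : ℂ) ^ 2 * (σ : ℂ) ^ 2 / 2 +
      ∫ x, levyKernel u x ∂levyMeasure p := by
  rw [levyExponent, hp.integral_levyMeasure]
  congr 2
  ext x
  rw [levyKernel, Complex.real_smul, mul_comm]

theorem IsLevyDensity.norm_integral_levyKernel_le (hp : IsLevyDensity p) (u : ℝ) :
    ‖∫ x, levyKernel u x ∂levyMeasure p‖ ≤
      3 * (1 + u ^ 2) * ∫ x, min 1 (x ^ 2) ∂levyMeasure p := by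
  rw [← integral_const_mul]
  exact norm_integral_le_of_norm_le (hp.integrable_min.const_mul _)
    (Eventually.of_forall (norm_levyKernel_le u))

theorem IsLevyDensity.exists_norm_levyExponent_le (hp : IsLevyDensity p) (b σ : ℝ) :
    ∃ C, ∀ u, ‖levyExponent b σ p u‖ ≤ C * (1 + u ^ 2) := by
  refine ⟨|b| + σ ^ 2 / 2 + 3 * ∫ x, min 1 (x ^ 2) ∂levyMeasure p, fun u => ?_⟩
  rw [hp.levyExponent_eq]
  have h1 : ‖Complex.I * u * b‖ ≤ |b| * (1 + u ^ 2) := by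
    have : ‖Complex.I * u * b‖ = |b| * |u| := by simp [mul_comm]
    rw [this]
    have h : |u| ≤ 1 + u ^ 2 := by
      rw [← sq_abs]
      nlinarith [sq_nonneg (|u| - 1), abs_nonneg u]
    gcongr
  have h2 : ‖(u : ℂ) ^ 2 * (σ : ℂ) ^ 2 / 2‖ ≤ σ ^ 2 / 2 * (1 + u ^ 2) := by
    have : ‖(u : ℂ) ^ 2 * (σ : ℂ) ^ 2 / 2‖ = u ^ 2 * σ ^ 2 / 2 := by simp
    rw [this]
    nlinarith [sq_nonneg σ]
  have h3 := hp.norm_integral_levyKernel_le u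
  calc _ ≤ ‖Complex.I * u * b‖ + ‖(u : ℂ) ^ 2 * (σ : ℂ) ^ 2 / 2‖ +
        ‖∫ x, levyKernel u x ∂levyMeasure p‖ :=
      (norm_add_le _ _).trans (by gcongr; exact norm_sub_le _ _)
    _ ≤ _ := by linarith

theorem IsLevyDensity.measurable_levyExponent (hp : IsLevyDensity p) (b σ : ℝ) :
    Measurable (levyExponent b σ p) := by
  have h : Measurable fun u => ∫ x, levyKernel u x ∂levyMeasure p :=
    ((measurable_levyKernel measurable_fst measurable_snd).stronglyMeasurable.integral_prod_right (f := levyKernel)).measurable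
  have he : levyExponent b σ p = fun u : ℝ => Complex.I * u * b - (u : ℂ) ^ 2 * (σ : ℂ) ^ 2 / 2 +
      ∫ x, levyKernel u x ∂levyMeasure p := funext (hp.levyExponent_eq b σ)
  rw [he]
  fun_prop

end Exponent

/-! ### The weight `1 - exp(-x²/2)` and its Fourier description. -/

section GaussWeight

/-- The weight `1 - exp (-x² / 2)`: one minus the characteristic function of the standard Gaussian
distribution. -/
noncomputable def gaussWeight (x : ℝ) : ℝ := 1 - Real.exp (-(x ^ 2 / 2))

theorem continuous_gaussWeight : Continuous gaussWeight := by
  unfold gaussWeight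
  fun_prop

theorem gaussWeight_nonneg (x : ℝ) : 0 ≤ gaussWeight x := by
  rw [gaussWeight, sub_nonneg, Real.exp_le_one_iff]
  nlinarith [sq_nonneg x]

theorem gaussWeight_le (x : ℝ) : gaussWeight x ≤ min 1 (x ^ 2) := by
  refine le_min ?_ ?_
  · rw [gaussWeight]
    linarith [Real.exp_pos (-(x ^ 2 / 2))]
  · rw [gaussWeight]
    nlinarith [Real.add_one_le_exp (-(x ^ 2 / 2)), sq_nonneg x]

theorem gaussWeight_mono {x y : ℝ} (h : |x| ≤ |y|) : gaussWeight x ≤ gaussWeight y := by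
  unfold gaussWeight
  have := sq_le_sq.2 h
  gcongr

theorem gaussWeight_pos {x : ℝ} (hx : x ≠ 0) : 0 < gaussWeight x := by
  rw [gaussWeight, sub_pos, Real.exp_lt_one_iff]
  have := pow_pos (abs_pos.2 hx) 2
  rw [sq_abs] at this
  linarith

theorem integral_exp_gaussianReal (x : ℝ) :
    ∫ v, Complex.exp (Complex.I * v * x) ∂gaussianReal 0 1 = 1 - gaussWeight x := by
  have h := charFun_gaussianReal (μ := 0) (v := 1) x
  rw [charFun_apply_real] at h
  have h' : ∀ v : ℝ, Complex.I * v * x = x * v * Complex.I := fun v => by ring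
  simp_rw [h', h, gaussWeight]
  push_cast
  ring_nf

theorem integrable_exp_I_mul_mul (μ : Measure ℝ) [IsFiniteMeasure μ] (x : ℝ) :
    Integrable (fun v : ℝ => Complex.exp (Complex.I * v * x)) μ :=
  (integrable_const (1 : ℝ)).mono' (by fun_prop)
    (Eventually.of_forall fun v => (norm_exp_I_mul_mul v x).le)

/-- Integrating a smoothed difference of exponentials produces the Gaussian weight. -/
theorem integral_exp_sub_exp_gaussianReal (u x : ℝ) :
    ∫ v, (Complex.exp (Complex.I * u * x) - Complex.exp (Complex.I * (u + v : ℝ) * x))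
      ∂gaussianReal 0 1 = gaussWeight x * Complex.exp (Complex.I * u * x) := by
  have h : ∀ v : ℝ, Complex.exp (Complex.I * u * x) - Complex.exp (Complex.I * (u + v : ℝ) * x) =
      Complex.exp (Complex.I * u * x) * (1 - Complex.exp (Complex.I * v * x)) := fun v => by
    rw [mul_sub, mul_one, ← Complex.exp_add]
    push_cast
    ring_nf
  simp_rw [h]
  rw [integral_const_mul, integral_sub (integrable_const _) (integrable_exp_I_mul_mul _ x),
    integral_exp_gaussianReal]
  simp
  ring

theorem charFun_withDensity_gaussWeight (μ : Measure ℝ) (u : ℝ) :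
    charFun (μ.withDensity fun x => ENNReal.ofReal (gaussWeight x)) u =
      ∫ x, gaussWeight x * Complex.exp (Complex.I * u * x) ∂μ := by
  rw [charFun_apply_real, integral_withDensity_ofReal continuous_gaussWeight.aemeasurable
    (Eventually.of_forall gaussWeight_nonneg)]
  refine integral_congr_ae (Eventually.of_forall fun x => ?_)
  simp only [Complex.real_smul]
  ring_nf

theorem charFun_eq_integral_exp (μ : Measure ℝ) (u : ℝ) :
    charFun μ u = ∫ x, Complex.exp (Complex.I * u * x) ∂μ := by
  rw [charFun_apply_real]
  refine integral_congr_ae (Eventually.of_forall fun x => ?_)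
  ring_nf

/-- Fubini, applied to the Gaussian average of a difference of exponentials. The weighted measure is
thus accessible from the characteristic function of `μ` alone, which is all that Lévy-Khintchine
provides. -/
theorem charFun_gaussWeight_eq_integral (μ : Measure ℝ) [IsFiniteMeasure μ] (u : ℝ) :
    charFun (μ.withDensity fun x => ENNReal.ofReal (gaussWeight x)) u =
      ∫ v, (charFun μ u - charFun μ (u + v)) ∂gaussianReal 0 1 := by
  have hi : ∀ u : ℝ, Integrable (fun x : ℝ => Complex.exp (Complex.I * u * x)) μ := fun u =>
    (integrable_const (1 : ℝ)).mono' (by fun_prop)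
      (Eventually.of_forall fun x => (norm_exp_I_mul_mul u x).le)
  rw [charFun_withDensity_gaussWeight]
  simp_rw [← integral_exp_sub_exp_gaussianReal]
  rw [integral_integral_swap]
  · refine integral_congr_ae (Eventually.of_forall fun v => ?_)
    simp only
    rw [integral_sub (hi _) (hi _), charFun_eq_integral_exp, charFun_eq_integral_exp]
  · refine (integrable_const (2 : ℝ)).mono' (by fun_prop) (Eventually.of_forall fun z => ?_)
    refine (norm_sub_le _ _).trans ?_
    rw [norm_exp_I_mul_mul, norm_exp_I_mul_mul]
    norm_num

end GaussWeight

/-! ### Small-time asymptotics of an infinitely divisible law. -/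

section Limit

variable {p : ℝ → ℝ}

theorem integrable_sq_gaussianReal : Integrable (fun v : ℝ => v ^ 2) (gaussianReal 0 1) :=
  (memLp_id_gaussianReal (μ := 0) (v := 1) 2).integrable_sq

theorem integrable_id_gaussianReal : Integrable (fun v : ℝ => v) (gaussianReal 0 1) :=
  (memLp_id_gaussianReal (μ := 0) (v := 1) 1).integrable le_rfl

theorem integral_sq_gaussianReal : ∫ v, v ^ 2 ∂gaussianReal 0 1 = 1 := by
  have h := variance_id_gaussianReal (μ := 0) (v := 1)
  rw [variance_eq_sub (memLp_id_gaussianReal (μ := 0) (v := 1) 2)] at h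
  simpa using h

/-- The weak limit of the rescaled and weighted small-time laws. -/
noncomputable def limitMeasure (σ : ℝ) (p : ℝ → ℝ) : Measure ℝ :=
  ENNReal.ofReal (σ ^ 2 / 2) • Measure.dirac 0 +
    (levyMeasure p).withDensity fun x => ENNReal.ofReal (gaussWeight x)

theorem IsLevyDensity.integrable_gaussWeight (hp : IsLevyDensity p) :
    Integrable gaussWeight (levyMeasure p) :=
  hp.integrable_of_norm_le continuous_gaussWeight.aestronglyMeasurable 1 fun x => by
    rw [Real.norm_of_nonneg (gaussWeight_nonneg x), one_mul]
    exact gaussWeight_le x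

theorem IsLevyDensity.isFiniteMeasure_withDensity (hp : IsLevyDensity p) :
    IsFiniteMeasure ((levyMeasure p).withDensity fun x => ENNReal.ofReal (gaussWeight x)) :=
  isFiniteMeasure_withDensity_ofReal hp.integrable_gaussWeight.2

theorem IsLevyDensity.isFiniteMeasure_limitMeasure (hp : IsLevyDensity p) (σ : ℝ) :
    IsFiniteMeasure (limitMeasure σ p) := by
  have := hp.isFiniteMeasure_withDensity
  have := Measure.smul_finite (Measure.dirac (0 : ℝ)) (ENNReal.ofReal_ne_top (r := σ ^ 2 / 2))
  unfold limitMeasure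
  infer_instance

theorem IsLevyDensity.integral_limitMeasure (hp : IsLevyDensity p) (σ : ℝ) {E : Type*}
    [NormedAddCommGroup E] [NormedSpace ℝ E] [CompleteSpace E] {f : ℝ → E} (hf : Continuous f)
    {C : ℝ} (hC : ∀ x, ‖f x‖ ≤ C) :
    ∫ x, f x ∂limitMeasure σ p =
      (σ ^ 2 / 2) • f 0 + ∫ x, gaussWeight x • f x ∂levyMeasure p := by
  have := hp.isFiniteMeasure_withDensity
  have := Measure.smul_finite (Measure.dirac (0 : ℝ)) (ENNReal.ofReal_ne_top (r := σ ^ 2 / 2))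
  rw [limitMeasure, integral_add_measure, integral_smul_measure, integral_dirac,
    ENNReal.toReal_ofReal (by positivity), integral_withDensity_ofReal
    continuous_gaussWeight.aemeasurable (Eventually.of_forall gaussWeight_nonneg)]
  · exact (integrable_const C).mono' hf.stronglyMeasurable.aestronglyMeasurable (Eventually.of_forall hC)
  · exact (integrable_const C).mono' hf.stronglyMeasurable.aestronglyMeasurable (Eventually.of_forall hC)

theorem IsLevyDensity.integrable_levyKernel_sub (hp : IsLevyDensity p) (u : ℝ) :
    Integrable (fun z : ℝ × ℝ => levyKernel u z.2 - levyKernel (u + z.1) z.2)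
      ((gaussianReal 0 1).prod (levyMeasure p)) := by
  have hv : Integrable (fun v : ℝ => 3 * (1 + u ^ 2) + 3 * (1 + (2 * u ^ 2 + 2 * v ^ 2)))
      (gaussianReal 0 1) := by
    have := integrable_sq_gaussianReal
    fun_prop
  have hm : Measurable fun z : ℝ × ℝ => levyKernel u z.2 - levyKernel (u + z.1) z.2 := by
    have h3 := measurable_levyKernel (measurable_const (a := u)) (measurable_snd (α := ℝ) (β := ℝ))
    have h4 := measurable_levyKernel (measurable_fst (α := ℝ) (β := ℝ) |>.const_add u)
      measurable_snd
    exact h3.sub h4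
  have hdom := hv.mul_prod hp.integrable_min
  refine hdom.mono' hm.aestronglyMeasurable (Eventually.of_forall fun z => ?_)
  · refine (norm_sub_le _ _).trans ?_
    rw [add_mul]
    have h : (0 : ℝ) ≤ min 1 (z.2 ^ 2) := le_min zero_le_one (sq_nonneg _)
    refine add_le_add (norm_levyKernel_le _ _) ((norm_levyKernel_le _ _).trans ?_)
    gcongr
    nlinarith [sq_nonneg (u - z.1)]

theorem integral_levyKernel_sub_gaussianReal (u x : ℝ) :
    ∫ v, (levyKernel u x - levyKernel (u + v) x) ∂gaussianReal 0 1 =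
      gaussWeight x * Complex.exp (Complex.I * u * x) := by
  have h : ∀ v : ℝ, levyKernel u x - levyKernel (u + v) x =
      (Complex.exp (Complex.I * u * x) - Complex.exp (Complex.I * (u + v : ℝ) * x)) +
        (v : ℂ) * (Complex.I * x * (if |x| ≤ 1 then 1 else 0)) := fun v => by
    simp only [levyKernel]
    push_cast
    ring
  have hi : Integrable (fun v : ℝ => (v : ℂ)) (gaussianReal 0 1) :=
    integrable_id_gaussianReal.ofReal
  simp_rw [h]
  rw [integral_add _ (hi.mul_const _), integral_exp_sub_exp_gaussianReal, integral_mul_const,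
    integral_complex_ofReal, integral_id_gaussianReal]
  · simp
  · refine (integrable_const (2 : ℝ)).mono' (by fun_prop) (Eventually.of_forall fun z => ?_)
    refine (norm_sub_le _ _).trans ?_
    rw [norm_exp_I_mul_mul, norm_exp_I_mul_mul]
    norm_num

/-- In `ψ(u) - ψ(u + v)` the drift contributes a term linear in `v`, which has Gaussian mean zero.
The quadratic part contributes `σ² u v + σ² v²/2`, with mean `σ²/2`: the atom at `0`. The
compensator is also linear in `v` and drops out, leaving the weighted Lévy measure. -/
theorem IsLevyDensity.charFun_limitMeasure (hp : IsLevyDensity p) (b σ u : ℝ) :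
    charFun (limitMeasure σ p) u =
      ∫ v, (levyExponent b σ p u - levyExponent b σ p (u + v)) ∂gaussianReal 0 1 := by
  have hl : charFun (limitMeasure σ p) u = ((σ ^ 2 / 2 : ℝ) : ℂ) +
      ∫ x, gaussWeight x * Complex.exp (Complex.I * u * x) ∂levyMeasure p := by
    rw [charFun_eq_integral_exp, hp.integral_limitMeasure σ (by fun_prop)
      (fun x => (norm_exp_I_mul_mul u x).le)]
    simp
  have hk := hp.integrable_levyKernel_sub u
  have hr : ∀ v : ℝ, levyExponent b σ p u - levyExponent b σ p (u + v) =
      ((v : ℂ) * (σ ^ 2 * u - Complex.I * b) + ((v ^ 2 : ℝ) : ℂ) * ((σ : ℂ) ^ 2 / 2)) +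
        ∫ x, (levyKernel u x - levyKernel (u + v) x) ∂levyMeasure p := fun v => by
    rw [hp.levyExponent_eq, hp.levyExponent_eq,
      integral_sub (hp.integrable_levyKernel _) (hp.integrable_levyKernel _)]
    push_cast
    ring
  have h1 : Integrable (fun v : ℝ => (v : ℂ) * (σ ^ 2 * u - Complex.I * b)) (gaussianReal 0 1) :=
    integrable_id_gaussianReal.ofReal.mul_const _
  have h2 : Integrable (fun v : ℝ => ((v ^ 2 : ℝ) : ℂ) * ((σ : ℂ) ^ 2 / 2)) (gaussianReal 0 1) :=
    integrable_sq_gaussianReal.ofReal.mul_const _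
  have h12 : Integrable (fun v : ℝ => (v : ℂ) * (σ ^ 2 * u - Complex.I * b) +
      ((v ^ 2 : ℝ) : ℂ) * ((σ : ℂ) ^ 2 / 2)) (gaussianReal 0 1) := h1.add h2
  have h3 : Integrable (fun v : ℝ => ∫ x, (levyKernel u x - levyKernel (u + v) x) ∂levyMeasure p)
      (gaussianReal 0 1) := hk.integral_prod_left
  simp_rw [hr]
  rw [hl, integral_add h12 h3, integral_add h1 h2,
    integral_mul_const, integral_mul_const, integral_complex_ofReal, integral_complex_ofReal,
    integral_sq_gaussianReal, integral_id_gaussianReal, integral_integral_swap hk]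
  simp_rw [integral_levyKernel_sub_gaussianReal]
  simp

theorem tendsto_nat_mul_exp_sub_one (z : ℂ) :
    Tendsto (fun n : ℕ => (n : ℂ) * (Complex.exp (z / n) - 1)) atTop (𝓝 z) := by
  have h : HasDerivAt (fun t : ℂ => Complex.exp (t * z)) z 0 := by
    simpa using ((hasDerivAt_id (0 : ℂ)).mul_const z).cexp
  have h2 := h.tendsto_slope_zero
  have h3 : Tendsto (fun n : ℕ => ((n : ℂ))⁻¹) atTop (𝓝[≠] 0) := by
    refine tendsto_nhdsWithin_iff.2 ⟨tendsto_inv_atTop_nhds_zero_nat, ?_⟩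
    filter_upwards [eventually_gt_atTop 0] with n hn
    simpa using hn.ne'
  refine (h2.comp h3).congr fun n => ?_
  simp [div_eq_inv_mul]

/-- No smallness of `z` is required, because for `‖z‖ > 1` the left side is at most `2`. Applied to
characteristic functions, this gives a domination uniform in `n`. -/
theorem norm_exp_sub_one_le_of_norm_exp_le_one {z : ℂ} (hz : ‖Complex.exp z‖ ≤ 1) :
    ‖Complex.exp z - 1‖ ≤ 2 * ‖z‖ := by
  rcases le_or_gt ‖z‖ 1 with h | h
  · exact Complex.norm_exp_sub_one_le h
  · refine (norm_sub_le _ _).trans ?_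
    rw [norm_one]
    linarith

variable {b σ T : ℝ} {μ : ℕ → Measure ℝ} [∀ n, IsProbabilityMeasure (μ n)]

/-- The rescaled and weighted laws of an infinitely divisible array. -/
theorem tendsto_charFun_rescaled (hp : IsLevyDensity p)
    (hμ : ∀ (n : ℕ) (u : ℝ), charFun (μ n) u = Complex.exp (T * levyExponent b σ p u / n)) (u : ℝ) :
    Tendsto (fun n : ℕ => (n : ℂ) * ∫ v, (charFun (μ n) u - charFun (μ n) (u + v))
      ∂gaussianReal 0 1) atTop (𝓝 (T * charFun (limitMeasure σ p) u)) := by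
  obtain ⟨C, hC⟩ := hp.exists_norm_levyExponent_le b σ
  have hm := hp.measurable_levyExponent b σ
  have hbound : ∀ (n : ℕ) (u : ℝ), ‖(n : ℂ) * (charFun (μ n) u - 1)‖ ≤
      2 * (|T| * (C * (1 + u ^ 2))) := by
    intro n u
    have h0 : 0 ≤ |T| * (C * (1 + u ^ 2)) :=
      mul_nonneg (abs_nonneg _) ((norm_nonneg _).trans (hC u))
    rcases Nat.eq_zero_or_pos n with rfl | hn
    · simpa using h0
    have hn' : (0 : ℝ) < n := by exact_mod_cast hn
    have h1 : ‖Complex.exp (T * levyExponent b σ p u / n)‖ ≤ 1 := by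
      rw [← hμ]
      exact norm_charFun_le_one _
    rw [hμ, norm_mul, Complex.norm_natCast]
    have h2 := norm_exp_sub_one_le_of_norm_exp_le_one h1
    rw [norm_div, norm_mul, Complex.norm_real, Complex.norm_natCast, Real.norm_eq_abs] at h2
    calc _ ≤ (n : ℝ) * (2 * (|T| * ‖levyExponent b σ p u‖ / n)) := by gcongr
      _ = 2 * (|T| * ‖levyExponent b σ p u‖) := by field_simp
      _ ≤ _ := by gcongr; exact hC u
  rw [hp.charFun_limitMeasure b]
  simp_rw [← integral_const_mul]
  refine tendsto_integral_of_dominated_convergence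
    (fun v => 2 * (|T| * (C * (1 + u ^ 2))) + 2 * (|T| * (C * (1 + (2 * u ^ 2 + 2 * v ^ 2)))))
    (fun n => ?_) ?_ (fun n => Eventually.of_forall fun v => ?_)
    (Eventually.of_forall fun v => ?_)
  · have hcm : Measurable (charFun (μ n)) := measurable_charFun
    exact Measurable.aestronglyMeasurable (by fun_prop)
  · have := integrable_sq_gaussianReal
    fun_prop
  · have h : (n : ℂ) * (charFun (μ n) u - charFun (μ n) (u + v)) =
        n * (charFun (μ n) u - 1) - n * (charFun (μ n) (u + v) - 1) := by ring
    rw [h]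
    refine (norm_sub_le _ _).trans (add_le_add (hbound n u) ((hbound n (u + v)).trans ?_))
    have hC0 : 0 ≤ C := by
      have := (norm_nonneg _).trans (hC 0)
      simpa using this
    gcongr
    nlinarith [sq_nonneg (u - v)]
  · have h := (tendsto_nat_mul_exp_sub_one (T * levyExponent b σ p u)).sub
      (tendsto_nat_mul_exp_sub_one (T * levyExponent b σ p (u + v)))
    rw [mul_sub]
    refine h.congr fun n => ?_
    rw [hμ, hμ]
    ring

/-- Small-time asymptotics: `n E g(Y_n) → T ∫ g dν` for bounded continuous `g` vanishing near the
origin. -/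
theorem tendsto_nat_mul_integral (hp : IsLevyDensity p) (hT : 0 ≤ T)
    (hμ : ∀ (n : ℕ) (u : ℝ), charFun (μ n) u = Complex.exp (T * levyExponent b σ p u / n))
    {g : ℝ → ℝ} (hg : Continuous g) {M : ℝ} (hM : ∀ x, |g x| ≤ M) {ε : ℝ} (hε : 0 < ε)
    (hgε : ∀ x, |x| < ε → g x = 0) :
    Tendsto (fun n : ℕ => (n : ℝ) * ∫ x, g x ∂μ n) atTop
      (𝓝 (T * ∫ x, g x ∂levyMeasure p)) := by
  have hg0 : g 0 = 0 := hgε 0 (by simpa using hε)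
  have hmul : ∀ x, gaussWeight x * (g x / gaussWeight x) = g x := fun x => by
    rcases eq_or_ne x 0 with rfl | hx
    · simp [hg0]
    · exact mul_div_cancel₀ _ (gaussWeight_pos hx).ne'
  -- The weight vanishes only at `0`, and near `0` the quotient is identically zero, with the
  -- convention `0 / 0 = 0` at the origin itself.
  have hqc : Continuous fun x => g x / gaussWeight x := by
    refine continuous_iff_continuousAt.2 fun x => ?_
    rcases eq_or_ne x 0 with rfl | hx
    · refine (continuousAt_const (y := (0 : ℝ))).congr ?_
      filter_upwards [Metric.ball_mem_nhds (0 : ℝ) hε] with y hy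
      rw [hgε y (by simpa using hy), zero_div]
    · exact hg.continuousAt.div continuous_gaussWeight.continuousAt (gaussWeight_pos hx).ne'
  have hqb : ∀ x, ‖g x / gaussWeight x‖ ≤ M / gaussWeight ε := fun x => by
    have hM0 : 0 ≤ M := (abs_nonneg _).trans (hM 0)
    rcases lt_or_ge |x| ε with hx | hx
    · rw [hgε x hx, zero_div, norm_zero]
      exact div_nonneg hM0 (gaussWeight_nonneg _)
    · rw [norm_div, Real.norm_eq_abs, Real.norm_of_nonneg (gaussWeight_nonneg _)]
      have := gaussWeight_pos hε.ne'
      have := gaussWeight_mono ((abs_of_pos hε).trans_le hx)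
      gcongr
      exact hM x
  let q : BoundedContinuousFunction ℝ ℝ := BoundedContinuousFunction.ofNormedAddCommGroup
    (fun x => g x / gaussWeight x) hqc _ hqb
  have hfin := hp.isFiniteMeasure_limitMeasure σ
  let ρ : ℕ → Measure ℝ := fun n => (n : ℝ≥0) •
    (μ n).withDensity fun x => ENNReal.ofReal (gaussWeight x)
  have hwf : ∀ n, IsFiniteMeasure ((μ n).withDensity fun x => ENNReal.ofReal (gaussWeight x)) :=
    fun n => isFiniteMeasure_withDensity_ofReal
      ((integrable_const (1 : ℝ)).mono' continuous_gaussWeight.aestronglyMeasurable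
        (Eventually.of_forall fun x => by
          rw [Real.norm_of_nonneg (gaussWeight_nonneg x)]
          exact (gaussWeight_le x).trans (min_le_left _ _))).2
  have hρ : ∀ n, IsFiniteMeasure (ρ n) := fun n => by
    have := hwf n
    infer_instance
  have hlim := tendsto_integral_of_tendsto_charFun (ρ := ρ)
    (ρ₀ := T.toNNReal • limitMeasure σ p) (fun t => ?_) q
  · have h1 : ∀ n, ∫ x, q x ∂ρ n = n * ∫ x, g x ∂μ n := fun n => by
      rw [integral_smul_nnreal_measure, integral_withDensity_ofReal
        continuous_gaussWeight.aemeasurable (Eventually.of_forall gaussWeight_nonneg)]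
      simp only [smul_eq_mul, NNReal.smul_def, NNReal.coe_natCast]
      congr 2
      ext x
      exact hmul x
    have h2 : ∫ x, q x ∂(T.toNNReal • limitMeasure σ p) = T * ∫ x, g x ∂levyMeasure p := by
      rw [integral_smul_nnreal_measure, hp.integral_limitMeasure σ q.continuous hqb]
      -- This removes the Gaussian atom of the limit, so `σ` disappears from the result.
      have hq0 : q 0 = 0 := by simp [q, hg0]
      rw [hq0, smul_zero, zero_add, NNReal.smul_def, Real.coe_toNNReal _ hT, smul_eq_mul]
      congr 2
      ext x
      exact hmul x
    simpa only [h1, h2] using hlim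
  · have h1 : ∀ n, charFun (ρ n) t =
        (n : ℂ) * ∫ v, (charFun (μ n) t - charFun (μ n) (t + v)) ∂gaussianReal 0 1 := fun n => by
      rw [← charFun_gaussWeight_eq_integral, charFun_apply, integral_smul_nnreal_measure,
        ← charFun_apply, NNReal.smul_def, Complex.real_smul]
      simp
    have h2 : charFun (T.toNNReal • limitMeasure σ p) t = T * charFun (limitMeasure σ p) t := by
      rw [charFun_apply, integral_smul_nnreal_measure, ← charFun_apply, NNReal.smul_def,
        Complex.real_smul, Real.coe_toNNReal _ hT]
    rw [h2]
    simp_rw [h1]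
    exact tendsto_charFun_rescaled hp hμ t

end Limit

/-! ### Passing to the limit in expectations. -/

section UniformIntegrability

variable {Ω : Type*} [MeasurableSpace Ω] {P : Measure Ω} [IsProbabilityMeasure P]

/-- Convergence of expectations under bounded second moments. -/
theorem tendsto_integral_of_integral_sq_le {F : ℕ → Ω → ℝ} {G : Ω → ℝ}
    (hF : ∀ n, AEStronglyMeasurable (F n) P) (hF0 : ∀ n ω, 0 ≤ F n ω)
    (hlim : ∀ᵐ ω ∂P, Tendsto (fun n => F n ω) atTop (𝓝 (G ω)))
    (h_int : ∀ n, Integrable (fun ω => F n ω ^ 2) P) {C : ℝ} (hC : ∀ n, ∫ ω, F n ω ^ 2 ∂P ≤ C) :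
    Integrable G P ∧ Tendsto (fun n => ∫ ω, F n ω ∂P) atTop (𝓝 (∫ ω, G ω ∂P)) := by
  have hGm : AEStronglyMeasurable G P := aestronglyMeasurable_of_tendsto_ae atTop hF hlim
  have hG0 : ∀ᵐ ω ∂P, 0 ≤ G ω := by
    filter_upwards [hlim] with ω hω using ge_of_tendsto' hω fun n => hF0 n ω
  have hFi : ∀ n, Integrable (F n) P := fun n =>
    ((integrable_const (1 : ℝ)).add (h_int n)).mono' (hF n) (Eventually.of_forall fun ω => by
      rw [Real.norm_of_nonneg (hF0 n ω), Pi.add_apply]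
      nlinarith [sq_nonneg (F n ω - 1), hF0 n ω])
  have hF1 : ∀ n, ∫ ω, F n ω ∂P ≤ 1 + C := fun n => by
    calc ∫ ω, F n ω ∂P ≤ ∫ ω, (1 + F n ω ^ 2) ∂P :=
          integral_mono (hFi n) ((integrable_const (1 : ℝ)).add (h_int n)) fun ω => by
            dsimp only
            nlinarith [sq_nonneg (F n ω - 1), hF0 n ω]
      _ ≤ 1 + C := by
          rw [integral_add (integrable_const _) (h_int n)]
          simpa using hC n
  have hGi : Integrable G P := by
    refine ⟨hGm, ?_⟩
    -- Fatou's lemma; the first moments are bounded because `x ≤ 1 + x²`.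
    have h1 : ∫⁻ ω, ‖G ω‖ₑ ∂P ≤ liminf (fun n => ∫⁻ ω, ‖F n ω‖ₑ ∂P) atTop := by
      refine le_trans (le_of_eq ?_) (lintegral_liminf_le' fun n => (hF n).enorm)
      refine lintegral_congr_ae ?_
      filter_upwards [hlim] with ω hω
      exact hω.enorm.liminf_eq.symm
    have h2 : ∀ n, ∫⁻ ω, ‖F n ω‖ₑ ∂P ≤ ENNReal.ofReal (1 + C) := fun n => by
      rw [← ofReal_integral_norm_eq_lintegral_enorm (hFi n)]
      refine ENNReal.ofReal_le_ofReal ?_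
      simpa only [Real.norm_of_nonneg (hF0 n _)] using hF1 n
    refine lt_of_le_of_lt (h1.trans ?_) (ENNReal.ofReal_lt_top (r := 1 + C))
    exact liminf_le_of_le (by isBoundedDefault) fun b hb => by
      obtain ⟨n, hn⟩ := hb.exists
      exact hn.trans (h2 n)
  refine ⟨hGi, ?_⟩
  have htrunc : ∀ K : ℕ, Tendsto (fun n => ∫ ω, min (F n ω) K ∂P) atTop
      (𝓝 (∫ ω, min (G ω) K ∂P)) := fun K => by
    refine tendsto_integral_of_dominated_convergence (fun _ => (K : ℝ))
      (fun n => (hF n).inf aestronglyMeasurable_const) (integrable_const _)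
      (fun n => Eventually.of_forall fun ω => ?_) ?_
    · rw [Real.norm_of_nonneg (le_min (hF0 n ω) (Nat.cast_nonneg K))]
      exact min_le_right _ _
    · filter_upwards [hlim] with ω hω using hω.min tendsto_const_nhds
  have hK : Tendsto (fun K : ℕ => ∫ ω, min (G ω) K ∂P) atTop (𝓝 (∫ ω, G ω ∂P)) := by
    refine tendsto_integral_of_dominated_convergence G
      (fun n => hGm.inf aestronglyMeasurable_const) hGi (fun n => ?_)
      (Eventually.of_forall fun ω => ?_)
    · filter_upwards [hG0] with ω hω
      rw [Real.norm_of_nonneg (le_min hω (Nat.cast_nonneg n))]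
      exact min_le_left _ _
    · refine tendsto_const_nhds.congr' ?_
      filter_upwards [eventually_ge_atTop ⌈G ω⌉₊] with n hn
      exact (min_eq_left ((Nat.le_ceil _).trans (by exact_mod_cast hn))).symm
  -- Truncation at `K` costs at most `C / K` uniformly in `n`, by `x - min x K ≤ x² / K` for `x ≥
  -- 0`.
  have herr : ∀ (K : ℕ), 0 < K → ∀ n, |∫ ω, F n ω ∂P - ∫ ω, min (F n ω) K ∂P| ≤ C / K := by
    intro K hK0 n
    have hK' : (0 : ℝ) < K := by exact_mod_cast hK0
    have hmi : Integrable (fun ω => min (F n ω) (K : ℝ)) P := (hFi n).inf (integrable_const _)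
    rw [← integral_sub (hFi n) hmi, abs_of_nonneg (integral_nonneg fun ω => by
      simp only [Pi.zero_apply, sub_nonneg]; exact min_le_left _ _)]
    calc _ ≤ ∫ ω, F n ω ^ 2 / K ∂P := by
          refine integral_mono ((hFi n).sub hmi) ((h_int n).div_const _) fun ω => ?_
          dsimp only
          rw [le_div_iff₀ hK']
          rcases le_total (F n ω) K with h | h
          · rw [min_eq_left h, sub_self, zero_mul]
            positivity
          · rw [min_eq_right h]
            nlinarith [hF0 n ω]
      _ ≤ C / K := by
          rw [integral_div]
          gcongr
          exact hC n
  rw [Metric.tendsto_nhds]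
  intro ε hε
  have hCK : Tendsto (fun K : ℕ => C / (K : ℝ)) atTop (𝓝 0) := tendsto_const_div_atTop_nhds_zero_nat C
  obtain ⟨K, h1, h2, h3⟩ := ((hCK.eventually (gt_mem_nhds (by positivity : 0 < ε / 3))).and
    (((Metric.tendsto_nhds.1 hK) (ε / 3) (by positivity)).and (eventually_gt_atTop 0))).exists
  filter_upwards [(Metric.tendsto_nhds.1 (htrunc K)) (ε / 3) (by positivity)] with n hn
  have h4 := herr K h3 n
  rw [Real.dist_eq, abs_lt] at *
  rw [abs_le] at h4
  constructor <;> linarith [h4.1, h4.2, h2.1, h2.2, hn.1, hn.2]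

end UniformIntegrability

/-! ### Test functions and their closure properties. -/

/-- Nonnegative bounded continuous functions vanishing near the origin. -/
structure IsTestFunction (g : ℝ → ℝ) : Prop where
  continuous : Continuous g
  nonneg : ∀ x, 0 ≤ g x
  bounded : ∃ M, ∀ x, g x ≤ M
  vanish : ∃ ε > 0, ∀ x, |x| < ε → g x = 0

namespace IsTestFunction

variable {f g : ℝ → ℝ}

theorem add (hf : IsTestFunction f) (hg : IsTestFunction g) :
    IsTestFunction fun x => f x + g x := by
  obtain ⟨M, hM⟩ := hf.bounded
  obtain ⟨M', hM'⟩ := hg.bounded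
  obtain ⟨ε, hε, hfε⟩ := hf.vanish
  obtain ⟨ε', hε', hgε⟩ := hg.vanish
  refine ⟨hf.continuous.add hg.continuous, fun x => add_nonneg (hf.nonneg x) (hg.nonneg x),
    ⟨M + M', fun x => add_le_add (hM x) (hM' x)⟩, min ε ε', lt_min hε hε', fun x hx => ?_⟩
  rw [hfε x (hx.trans_le (min_le_left _ _)), hgε x (hx.trans_le (min_le_right _ _)), add_zero]

theorem mul_bounded (hf : IsTestFunction f) (hg : Continuous g) (hg0 : ∀ x, 0 ≤ g x) {M : ℝ}
    (hM : ∀ x, g x ≤ M) : IsTestFunction fun x => f x * g x := by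
  obtain ⟨M', hM'⟩ := hf.bounded
  obtain ⟨ε, hε, hfε⟩ := hf.vanish
  refine ⟨hf.continuous.mul hg, fun x => mul_nonneg (hf.nonneg x) (hg0 x),
    ⟨M' * M, fun x => mul_le_mul (hM' x) (hM x) (hg0 x) ((hf.nonneg x).trans (hM' x))⟩, ε, hε,
    fun x hx => by rw [hfε x hx, zero_mul]⟩

theorem mul (hf : IsTestFunction f) (hg : IsTestFunction g) :
    IsTestFunction fun x => f x * g x := by
  obtain ⟨M, hM⟩ := hg.bounded
  exact hf.mul_bounded hg.continuous hg.nonneg hM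

theorem exp_sub_one (hf : IsTestFunction f) : IsTestFunction fun x => Real.exp (f x) - 1 := by
  obtain ⟨M, hM⟩ := hf.bounded
  obtain ⟨ε, hε, hfε⟩ := hf.vanish
  refine ⟨(Real.continuous_exp.comp hf.continuous).sub continuous_const, fun x => ?_,
    ⟨Real.exp M, fun x => ?_⟩, ε, hε, fun x hx => by rw [hfε x hx, Real.exp_zero, sub_self]⟩
  · have := Real.one_le_exp (hf.nonneg x)
    linarith
  · have := Real.exp_le_exp.2 (hM x)
    linarith

theorem integrable (hf : IsTestFunction f) (μ : Measure ℝ) [IsFiniteMeasure μ] :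
    Integrable f μ := by
  obtain ⟨M, hM⟩ := hf.bounded
  exact (integrable_const M).mono' hf.continuous.aestronglyMeasurable
    (Eventually.of_forall fun x => by rw [Real.norm_of_nonneg (hf.nonneg x)]; exact hM x)

end IsTestFunction

/-! ### Moments of increment sums, and Campbell's formulas for test functions. -/

section Increments

variable {Ω : Type*} [MeasurableSpace Ω] {P : Measure Ω}
  {X : ℝ≥0 → Ω → ℝ} {p : ℝ → ℝ}

theorem IsLevyProcess.charFun_map (hX : IsLevyProcess P X p) :
    ∃ b σ : ℝ, ∀ (t : ℝ≥0) (u : ℝ),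
      charFun (P.map (X t)) u = Complex.exp ((t : ℝ) * levyExponent b σ p u) := by
  obtain ⟨b, σ, h⟩ := hX.characteristic
  refine ⟨b, σ, fun t u => ?_⟩
  rw [charFun_eq_integral_exp, integral_map (hX.measurable t).aemeasurable (by fun_prop), h]

/-- The increments along the regular grid of `[0, T]`. -/
noncomputable def gridIncrement (X : ℝ≥0 → Ω → ℝ) (T : ℝ≥0) (n k : ℕ) (ω : Ω) : ℝ :=
  X (gridTime T n (k + 1)) ω - X (gridTime T n k) ω

theorem IsLevyProcess.measurable_gridIncrement (hX : IsLevyProcess P X p) (T : ℝ≥0) (n k : ℕ) :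
    Measurable (gridIncrement X T n k) :=
  (hX.measurable _).sub (hX.measurable _)

theorem IsLevyProcess.iIndepFun_gridIncrement (hX : IsLevyProcess P X p) (T : ℝ≥0) (n : ℕ) :
    iIndepFun (gridIncrement X T n) P :=
  hX.indep_increments.nat (gridTime_mono T n)

theorem IsLevyProcess.ae_tendsto_incrementSum (hX : IsLevyProcess P X p) (T : ℝ≥0) {g : ℝ → ℝ}
    (hg : IsTestFunction g) :
    ∀ᵐ ω ∂P, Tendsto (incrementSum g T fun t => X t ω) atTop
      (𝓝 (∫⁻ x, ENNReal.ofReal (g x) ∂jumpSizes T fun t => X t ω).toReal) := by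
  obtain ⟨ε, hε, hgε⟩ := hg.vanish
  filter_upwards [hX.cadlag] with ω hω
  exact (hω.tendsto_incrementSum_lintegral T hg.continuous hg.nonneg hε hgε).2

theorem IsLevyProcess.measurable_incrementSum (hX : IsLevyProcess P X p) (T : ℝ≥0) {g : ℝ → ℝ}
    (hg : Continuous g) (n : ℕ) : Measurable fun ω => incrementSum g T (fun t => X t ω) n :=
  Finset.measurable_fun_sum _ fun k _ => hg.measurable.comp (hX.measurable_gridIncrement T n k)

variable [IsProbabilityMeasure P]

/-- Stationarity compares increments with `X h - X 0`; this identifies their law with that of `X h`,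
the one described by the Lévy-Khintchine formula. -/
theorem IsLevyProcess.ae_zero (hX : IsLevyProcess P X p) : X 0 =ᵐ[P] 0 := by
  obtain ⟨b, σ, h⟩ := hX.charFun_map
  have : IsProbabilityMeasure (P.map (X 0)) :=
    Measure.isProbabilityMeasure_map (hX.measurable 0).aemeasurable
  have h0 : P.map (X 0) = Measure.dirac 0 := by
    refine Measure.ext_of_charFun (funext fun u => ?_)
    rw [h, charFun_dirac]
    simp
  have h1 : ∀ᵐ x ∂P.map (X 0), x = 0 := by
    rw [h0, ae_dirac_eq]
    rfl
  exact ae_of_ae_map (hX.measurable 0).aemeasurable h1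

theorem IsLevyProcess.map_gridIncrement (hX : IsLevyProcess P X p) (T : ℝ≥0) (n k : ℕ) :
    P.map (gridIncrement X T n k) = P.map (X (T / n)) := by
  have h := (hX.stationary_increments (gridTime T n k) (T / n)).map_eq
  rw [← gridTime_succ] at h
  refine h.trans (Measure.map_congr ?_)
  filter_upwards [hX.ae_zero] with ω hω
  simp [hω]

theorem IsLevyProcess.integral_gridIncrement (hX : IsLevyProcess P X p) (T : ℝ≥0) (n k : ℕ)
    {g : ℝ → ℝ} (hg : Continuous g) :
    ∫ ω, g (gridIncrement X T n k ω) ∂P = ∫ x, g x ∂P.map (X (T / n)) := by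
  rw [← hX.map_gridIncrement T n k, integral_map (hX.measurable_gridIncrement T n k).aemeasurable
    hg.aestronglyMeasurable]

theorem IsLevyProcess.tendsto_nat_mul_integral_map (hX : IsLevyProcess P X p) (T : ℝ≥0)
    {g : ℝ → ℝ} (hg : IsTestFunction g) :
    Tendsto (fun n : ℕ => (n : ℝ) * ∫ x, g x ∂P.map (X (T / n))) atTop
      (𝓝 (T * ∫ x, g x ∂levyMeasure p)) := by
  obtain ⟨b, σ, h⟩ := hX.charFun_map
  obtain ⟨M, hM⟩ := hg.bounded
  obtain ⟨ε, hε, hgε⟩ := hg.vanish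
  have : ∀ n : ℕ, IsProbabilityMeasure (P.map (X (T / n))) := fun n =>
    Measure.isProbabilityMeasure_map (hX.measurable _).aemeasurable
  refine tendsto_nat_mul_integral (T := (T : ℝ)) (b := b) (σ := σ) (μ := fun n : ℕ => P.map (X (T / n)))
    hX.levyDensity T.coe_nonneg (fun n u => ?_) hg.continuous
    (fun x => (abs_of_nonneg (hg.nonneg x)).trans_le (hM x)) hε hgε
  rw [h]
  push_cast
  congr 1
  ring

theorem incrementSum_nonneg {g : ℝ → ℝ} (hg : IsTestFunction g) (T : ℝ≥0) (f : ℝ≥0 → ℝ) (n : ℕ) :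
    0 ≤ incrementSum g T f n :=
  Finset.sum_nonneg fun _ _ => hg.nonneg _

theorem exists_incrementSum_le {g : ℝ → ℝ} (hg : IsTestFunction g) (T : ℝ≥0) (n : ℕ) :
    ∃ M, ∀ f, incrementSum g T f n ≤ M := by
  obtain ⟨M, hM⟩ := hg.bounded
  exact ⟨∑ _k ∈ Finset.range n, M, fun f => Finset.sum_le_sum fun _ _ => hM _⟩

theorem IsLevyProcess.integrable_incrementSum_pow (hX : IsLevyProcess P X p) (T : ℝ≥0) {g : ℝ → ℝ}
    (hg : IsTestFunction g) (n m : ℕ) :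
    Integrable (fun ω => incrementSum g T (fun t => X t ω) n ^ m) P := by
  obtain ⟨M, hM⟩ := exists_incrementSum_le hg T n
  refine (integrable_const (M ^ m)).mono'
    ((hX.measurable_incrementSum T hg.continuous n).pow_const m).aestronglyMeasurable
    (Eventually.of_forall fun ω => ?_)
  have h0 := incrementSum_nonneg hg T (fun t => X t ω) n
  rw [Real.norm_of_nonneg (pow_nonneg h0 m)]
  exact pow_le_pow_left₀ h0 (hM _) m

/-- By independence the exponential moment is `(1 + m)^n ≤ exp(n m)` with `m = E[exp(g(X(T/n))) -
1]`. Since `exp ∘ g - 1` is again a test function, `n m` converges and is therefore bounded in `n`.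
All polynomial moments are then bounded in `n` too. -/
theorem IsLevyProcess.exists_integral_exp_incrementSum_le (hX : IsLevyProcess P X p) (T : ℝ≥0)
    {g : ℝ → ℝ} (hg : IsTestFunction g) :
    ∃ C, ∀ n, ∫ ω, Real.exp (incrementSum g T (fun t => X t ω) n) ∂P ≤ C := by
  obtain ⟨B, hB⟩ := (hX.tendsto_nat_mul_integral_map T hg.exp_sub_one).bddAbove_range
  refine ⟨Real.exp B, fun n => ?_⟩
  have : IsProbabilityMeasure (P.map (X (T / n))) :=
    Measure.isProbabilityMeasure_map (hX.measurable _).aemeasurable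
  have hind := (hX.iIndepFun_gridIncrement T n).comp (fun _ => g) fun _ => hg.continuous.measurable
  have hm := hind.mgf_sum (t := 1) (fun k => hg.continuous.measurable.comp
    (hX.measurable_gridIncrement T n k)) (Finset.range n)
  have hterm : ∀ k, mgf (g ∘ gridIncrement X T n k) P 1 =
      1 + ∫ x, (Real.exp (g x) - 1) ∂P.map (X (T / n)) := fun k => by
    rw [← hX.integral_gridIncrement T n k hg.exp_sub_one.continuous, mgf, integral_sub]
    · simp
    · have h := (hg.exp_sub_one.integrable (P.map (X (T / n)))).add (integrable_const (1 : ℝ))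
      rw [← hX.map_gridIncrement T n k] at h
      have h' := h.comp_measurable (hX.measurable_gridIncrement T n k)
      refine h'.congr (Eventually.of_forall fun ω => ?_)
      simp
    · exact integrable_const _
  simp only [hterm, Finset.prod_const, Finset.card_range] at hm
  have hS : mgf (∑ k ∈ Finset.range n, g ∘ gridIncrement X T n k) P 1 =
      ∫ ω, Real.exp (incrementSum g T (fun t => X t ω) n) ∂P := by
    simp [mgf, incrementSum, gridIncrement]
  rw [← hS, hm]
  set m := ∫ x, (Real.exp (g x) - 1) ∂P.map (X (T / n)) with hmdef
  have hm0 : 0 ≤ m := integral_nonneg hg.exp_sub_one.nonneg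
  calc (1 + m) ^ n ≤ Real.exp m ^ n := by
        gcongr
        linarith [Real.add_one_le_exp m]
    _ = Real.exp (n * m) := (Real.exp_nat_mul m n).symm
    _ ≤ Real.exp B := Real.exp_le_exp.2 (hB ⟨n, rfl⟩)

theorem IsLevyProcess.exists_integral_incrementSum_pow_le (hX : IsLevyProcess P X p) (T : ℝ≥0)
    {g : ℝ → ℝ} (hg : IsTestFunction g) (m : ℕ) :
    ∃ C, ∀ n, ∫ ω, incrementSum g T (fun t => X t ω) n ^ m ∂P ≤ C := by
  obtain ⟨C, hC⟩ := hX.exists_integral_exp_incrementSum_le T hg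
  refine ⟨m.factorial * C, fun n => ?_⟩
  have hexp : Integrable (fun ω => Real.exp (incrementSum g T (fun t => X t ω) n)) P := by
    obtain ⟨M, hM⟩ := exists_incrementSum_le hg T n
    refine (integrable_const (Real.exp M)).mono'
      (hX.measurable_incrementSum T hg.continuous n).exp.aestronglyMeasurable
      (Eventually.of_forall fun ω => ?_)
    rw [Real.norm_of_nonneg (Real.exp_pos _).le]
    exact Real.exp_le_exp.2 (hM _)
  calc _ ≤ ∫ ω, m.factorial * Real.exp (incrementSum g T (fun t => X t ω) n) ∂P := by
        refine integral_mono (hX.integrable_incrementSum_pow T hg n m) (hexp.const_mul _)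
          fun ω => ?_
        have h := Real.pow_div_factorial_le_exp _ (incrementSum_nonneg hg T (fun t => X t ω) n) m
        rw [div_le_iff₀ (by positivity)] at h
        dsimp only
        linarith
    _ ≤ _ := by
        rw [integral_const_mul]
        gcongr
        exact hC n

theorem IsLevyProcess.integrable_comp_gridIncrement (hX : IsLevyProcess P X p) (T : ℝ≥0)
    (n k : ℕ) {g : ℝ → ℝ} (hg : IsTestFunction g) :
    Integrable (fun ω => g (gridIncrement X T n k ω)) P := by
  have : IsProbabilityMeasure (P.map (gridIncrement X T n k)) :=
    Measure.isProbabilityMeasure_map (hX.measurable_gridIncrement T n k).aemeasurable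
  exact (hg.integrable _).comp_measurable (hX.measurable_gridIncrement T n k)

theorem IsLevyProcess.integral_incrementSum (hX : IsLevyProcess P X p) (T : ℝ≥0) {g : ℝ → ℝ}
    (hg : IsTestFunction g) (n : ℕ) :
    ∫ ω, incrementSum g T (fun t => X t ω) n ∂P = n * ∫ x, g x ∂P.map (X (T / n)) := by
  have h : ∀ ω, incrementSum g T (fun t => X t ω) n =
      ∑ k ∈ Finset.range n, g (gridIncrement X T n k ω) := fun ω => rfl
  simp_rw [h]
  rw [integral_finsetSum _ fun k _ => hX.integrable_comp_gridIncrement T n k hg]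
  simp [hX.integral_gridIncrement T n _ hg.continuous]

/-- The `n` diagonal terms give the first summand and the `n (n - 1)` independent off-diagonal pairs
the other two. Writing everything through `n E[·]` shows convergent quantities, with a last term
that vanishes in the limit. -/
theorem IsLevyProcess.integral_incrementSum_mul (hX : IsLevyProcess P X p) (T : ℝ≥0) {f g : ℝ → ℝ}
    (hf : IsTestFunction f) (hg : IsTestFunction g) (n : ℕ) :
    ∫ ω, incrementSum f T (fun t => X t ω) n * incrementSum g T (fun t => X t ω) n ∂P =
      n * ∫ x, f x * g x ∂P.map (X (T / n)) +
      (n * ∫ x, f x ∂P.map (X (T / n))) * (n * ∫ x, g x ∂P.map (X (T / n))) -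
      (n * ∫ x, f x ∂P.map (X (T / n))) * (n * ∫ x, g x ∂P.map (X (T / n))) / n := by
  have h : ∀ ω, incrementSum f T (fun t => X t ω) n * incrementSum g T (fun t => X t ω) n =
      ∑ k ∈ Finset.range n, ∑ l ∈ Finset.range n,
        f (gridIncrement X T n k ω) * g (gridIncrement X T n l ω) := fun ω =>
    Finset.sum_mul_sum _ _ _ _
  have hdiag : ∀ k, Integrable (fun ω => f (gridIncrement X T n k ω) * g (gridIncrement X T n k ω))
      P := fun k => hX.integrable_comp_gridIncrement T n k (hf.mul hg)
  have hind : ∀ k l, k ≠ l → IndepFun (fun ω => f (gridIncrement X T n k ω))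
      (fun ω => g (gridIncrement X T n l ω)) P := fun k l hkl =>
    ((hX.iIndepFun_gridIncrement T n).indepFun hkl).comp hf.continuous.measurable
      hg.continuous.measurable
  have h_int : ∀ k l, Integrable (fun ω => f (gridIncrement X T n k ω) * g (gridIncrement X T n l ω))
      P := fun k l => by
    rcases eq_or_ne k l with rfl | hkl
    · exact hdiag k
    · exact (hind k l hkl).integrable_mul (hX.integrable_comp_gridIncrement T n k hf)
        (hX.integrable_comp_gridIncrement T n l hg)
  have hval : ∀ k l, ∫ ω, f (gridIncrement X T n k ω) * g (gridIncrement X T n l ω) ∂P =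
      (∫ x, f x ∂P.map (X (T / n))) * (∫ x, g x ∂P.map (X (T / n))) +
      if k = l then ∫ x, f x * g x ∂P.map (X (T / n)) -
        (∫ x, f x ∂P.map (X (T / n))) * (∫ x, g x ∂P.map (X (T / n))) else 0 := fun k l => by
    rcases eq_or_ne k l with rfl | hkl
    · rw [if_pos rfl, ← hX.integral_gridIncrement T n k (hf.mul hg).continuous]
      ring
    · rw [if_neg hkl, add_zero, (hind k l hkl).integral_fun_mul_eq_mul_integral
        (hX.integrable_comp_gridIncrement T n k hf).aestronglyMeasurable
        (hX.integrable_comp_gridIncrement T n l hg).aestronglyMeasurable,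
        hX.integral_gridIncrement T n k hf.continuous,
        hX.integral_gridIncrement T n l hg.continuous]
  simp_rw [h]
  rw [integral_finsetSum _ fun k _ => integrable_finsetSum _ fun l _ => h_int k l]
  simp_rw [fun k => integral_finsetSum (Finset.range n) fun l _ => h_int k l, hval,
    Finset.sum_add_distrib, Finset.sum_ite_eq, Finset.sum_const, Finset.card_range, nsmul_eq_mul]
  rw [Finset.sum_congr rfl fun k hk => if_pos hk, Finset.sum_const, Finset.card_range, nsmul_eq_mul]
  rcases Nat.eq_zero_or_pos n with rfl | hn
  · simp
  · have hn' : (n : ℝ) ≠ 0 := by exact_mod_cast hn.ne'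
    field_simp
    ring

/-- Campbell's formula for test functions. -/
theorem IsLevyProcess.integral_jumpSizes (hX : IsLevyProcess P X p) (T : ℝ≥0) {g : ℝ → ℝ}
    (hg : IsTestFunction g) :
    Integrable (fun ω => (∫⁻ x, ENNReal.ofReal (g x) ∂jumpSizes T fun t => X t ω).toReal) P ∧
    ∫ ω, (∫⁻ x, ENNReal.ofReal (g x) ∂jumpSizes T fun t => X t ω).toReal ∂P =
      T * ∫ x, g x ∂levyMeasure p := by
  obtain ⟨C, hC⟩ := hX.exists_integral_incrementSum_pow_le T hg 2
  obtain ⟨h1, h2⟩ := tendsto_integral_of_integral_sq_le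
    (fun n => (hX.measurable_incrementSum T hg.continuous n).aestronglyMeasurable)
    (fun n ω => incrementSum_nonneg hg T _ n) (hX.ae_tendsto_incrementSum T hg)
    (fun n => hX.integrable_incrementSum_pow T hg n 2) hC
  simp_rw [hX.integral_incrementSum T hg] at h2
  exact ⟨h1, tendsto_nhds_unique h2 (hX.tendsto_nat_mul_integral_map T hg)⟩

/-- The second order Campbell formula for test functions. -/
theorem IsLevyProcess.integral_jumpSizes_mul (hX : IsLevyProcess P X p) (T : ℝ≥0) {f g : ℝ → ℝ}
    (hf : IsTestFunction f) (hg : IsTestFunction g) :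
    Integrable (fun ω => (∫⁻ x, ENNReal.ofReal (f x) ∂jumpSizes T fun t => X t ω).toReal *
      (∫⁻ x, ENNReal.ofReal (g x) ∂jumpSizes T fun t => X t ω).toReal) P ∧
    ∫ ω, (∫⁻ x, ENNReal.ofReal (f x) ∂jumpSizes T fun t => X t ω).toReal *
      (∫⁻ x, ENNReal.ofReal (g x) ∂jumpSizes T fun t => X t ω).toReal ∂P =
      T * ∫ x, f x * g x ∂levyMeasure p +
        (T * ∫ x, f x ∂levyMeasure p) * (T * ∫ x, g x ∂levyMeasure p) := by
  obtain ⟨C, hC⟩ := hX.exists_integral_incrementSum_pow_le T (hf.add hg) 4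
  -- With `a, b ≥ 0` one has `a b ≤ (a + b)²`, so the fourth moment for the test function `f + g`
  -- supplies the required second moment bound.
  have hle : ∀ n ω, (incrementSum f T (fun t => X t ω) n * incrementSum g T (fun t => X t ω) n) ^ 2
      ≤ incrementSum (fun x => f x + g x) T (fun t => X t ω) n ^ 4 := fun n ω => by
    have hadd : incrementSum (fun x => f x + g x) T (fun t => X t ω) n =
        incrementSum f T (fun t => X t ω) n + incrementSum g T (fun t => X t ω) n :=
      Finset.sum_add_distrib
    have h1 := incrementSum_nonneg hf T (fun t => X t ω) n
    have h2 := incrementSum_nonneg hg T (fun t => X t ω) n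
    rw [hadd, show (4 : ℕ) = 2 * 2 from rfl, pow_mul]
    refine pow_le_pow_left₀ (mul_nonneg h1 h2) ?_ 2
    nlinarith
  have hm : ∀ n, Measurable fun ω =>
      incrementSum f T (fun t => X t ω) n * incrementSum g T (fun t => X t ω) n := fun n =>
    (hX.measurable_incrementSum T hf.continuous n).mul (hX.measurable_incrementSum T hg.continuous n)
  have h4 := fun n => hX.integrable_incrementSum_pow T (hf.add hg) n 4
  have h_int : ∀ n, Integrable (fun ω =>
      (incrementSum f T (fun t => X t ω) n * incrementSum g T (fun t => X t ω) n) ^ 2) P := fun n =>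
    (h4 n).mono' ((hm n).pow_const 2).aestronglyMeasurable (Eventually.of_forall fun ω => by
      rw [Real.norm_of_nonneg (sq_nonneg _)]
      exact hle n ω)
  have hlim : ∀ᵐ ω ∂P, Tendsto (fun n =>
      incrementSum f T (fun t => X t ω) n * incrementSum g T (fun t => X t ω) n) atTop
      (𝓝 ((∫⁻ x, ENNReal.ofReal (f x) ∂jumpSizes T fun t => X t ω).toReal *
        (∫⁻ x, ENNReal.ofReal (g x) ∂jumpSizes T fun t => X t ω).toReal)) := by
    filter_upwards [hX.ae_tendsto_incrementSum T hf, hX.ae_tendsto_incrementSum T hg] with ω h1 h2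
    exact h1.mul h2
  obtain ⟨h1, h2⟩ := tendsto_integral_of_integral_sq_le (fun n => (hm n).aestronglyMeasurable)
    (fun n ω => mul_nonneg (incrementSum_nonneg hf T _ n) (incrementSum_nonneg hg T _ n)) hlim h_int
    (fun n => (integral_mono (h_int n) (h4 n) (hle n)).trans (hC n))
  simp_rw [hX.integral_incrementSum_mul T hf hg] at h2
  refine ⟨h1, tendsto_nhds_unique h2 ?_⟩
  have hf' := hX.tendsto_nat_mul_integral_map T hf
  have hg' := hX.tendsto_nat_mul_integral_map T hg
  have hzero := (hf'.mul hg').div_atTop tendsto_natCast_atTop_atTop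
  simpa using ((hX.tendsto_nat_mul_integral_map T (hf.mul hg)).add (hf'.mul hg')).sub hzero

end Increments

/-! ### From test functions to measures that do not charge the origin. -/

section Cutoff

/-- Test functions increasing to the indicator of `ℝ \ {0}`. -/
noncomputable def cutoff (n : ℕ) (x : ℝ) : ℝ := min 1 (max 0 (n * |x| - 1))

theorem isTestFunction_cutoff (n : ℕ) : IsTestFunction (cutoff n) := by
  refine ⟨by unfold cutoff; fun_prop, fun x => le_min zero_le_one (le_max_left _ _),
    ⟨1, fun x => min_le_left _ _⟩, 1 / (n + 1), by positivity, fun x hx => ?_⟩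
  have h : (n : ℝ) * |x| - 1 ≤ 0 := by
    rw [lt_div_iff₀ (by positivity)] at hx
    nlinarith [abs_nonneg x]
  rw [cutoff, max_eq_left h, min_eq_right zero_le_one]

theorem cutoff_mono (x : ℝ) : Monotone fun n => cutoff n x := by
  intro n m hnm
  have : (n : ℝ) ≤ m := by exact_mod_cast hnm
  dsimp only [cutoff]
  gcongr

theorem iSup_ofReal_cutoff {x : ℝ} (hx : x ≠ 0) : ⨆ n, ENNReal.ofReal (cutoff n x) = 1 := by
  refine le_antisymm (iSup_le fun n => ?_) ?_
  · rw [← ENNReal.ofReal_one]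
    exact ENNReal.ofReal_le_ofReal (min_le_left _ _)
  · obtain ⟨n, hn⟩ := exists_nat_ge (2 / |x|)
    rw [div_le_iff₀ (abs_pos.2 hx)] at hn
    refine le_iSup_of_le n ?_
    rw [cutoff, min_eq_left (le_max_of_le_right (by linarith)), ENNReal.ofReal_one]

variable {μ ν : Measure ℝ}

theorem ae_ne_zero (hμ : μ {0} = 0) : ∀ᵐ x ∂μ, x ≠ 0 := by
  rw [ae_iff]
  simpa using hμ

theorem lintegral_eq_iSup_cutoff (hμ : μ {0} = 0) {f : ℝ → ℝ≥0∞} (hf : Measurable f) :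
    ∫⁻ x, f x ∂μ = ⨆ n, ∫⁻ x, ENNReal.ofReal (cutoff n x) * f x ∂μ := by
  have hm : ∀ n, Measurable fun x => ENNReal.ofReal (cutoff n x) * f x := fun n =>
    (isTestFunction_cutoff n).continuous.measurable.ennreal_ofReal.mul hf
  rw [← lintegral_iSup hm fun n m hnm x => by
    dsimp only
    gcongr
    exact cutoff_mono x hnm]
  refine lintegral_congr_ae ?_
  filter_upwards [ae_ne_zero hμ] with x hx
  rw [← ENNReal.iSup_mul, iSup_ofReal_cutoff hx, one_mul]

theorem measure_eq_iSup_cutoff (hμ : μ {0} = 0) {s : Set ℝ} (hs : MeasurableSet s) :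
    μ s = ⨆ n, (μ.withDensity fun x => ENNReal.ofReal (cutoff n x)) s := by
  have h := lintegral_eq_iSup_cutoff hμ (f := s.indicator 1) (measurable_one.indicator hs)
  rw [lintegral_indicator_one hs] at h
  rw [h]
  congr 1
  ext n
  rw [withDensity_apply _ hs, ← lintegral_indicator hs]
  refine lintegral_congr fun x => ?_
  by_cases hx : x ∈ s <;> simp [hx]

theorem cutoff_mul_boundedContinuous (n : ℕ) (f : BoundedContinuousFunction ℝ ℝ≥0) :
    IsTestFunction fun x => cutoff n x * (f x : ℝ) := by
  refine (isTestFunction_cutoff n).mul_bounded (by fun_prop) (fun x => (f x).coe_nonneg)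
    (M := nndist f 0) fun x => ?_
  exact_mod_cast BoundedContinuousFunction.NNReal.upper_bound f x

theorem lintegral_withDensity_cutoff (n : ℕ) (f : BoundedContinuousFunction ℝ ℝ≥0) :
    ∫⁻ x, f x ∂(μ.withDensity fun x => ENNReal.ofReal (cutoff n x)) =
      ∫⁻ x, ENNReal.ofReal (cutoff n x * (f x : ℝ)) ∂μ := by
  rw [lintegral_withDensity_eq_lintegral_mul _
    (isTestFunction_cutoff n).continuous.measurable.ennreal_ofReal (by fun_prop)]
  refine lintegral_congr fun x => ?_
  rw [Pi.mul_apply, ENNReal.ofReal_mul ((isTestFunction_cutoff n).nonneg x),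
    ENNReal.ofReal_coe_nnreal]

theorem isFiniteMeasure_withDensity_cutoff
    (h : ∀ g, IsTestFunction g → ∫⁻ x, ENNReal.ofReal (g x) ∂μ ≠ ∞) (n : ℕ) :
    IsFiniteMeasure (μ.withDensity fun x => ENNReal.ofReal (cutoff n x)) :=
  isFiniteMeasure_withDensity (h _ (isTestFunction_cutoff n))

/-- Measures on `ℝ \ {0}` are determined by the integrals of test functions. -/
theorem ext_of_lintegral_testFunction (hμ : μ {0} = 0) (hν : ν {0} = 0)
    (hfin : ∀ g, IsTestFunction g → ∫⁻ x, ENNReal.ofReal (g x) ∂μ ≠ ∞)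
    (h : ∀ g, IsTestFunction g →
      ∫⁻ x, ENNReal.ofReal (g x) ∂μ = ∫⁻ x, ENNReal.ofReal (g x) ∂ν) : μ = ν := by
  ext s hs
  rw [measure_eq_iSup_cutoff hμ hs, measure_eq_iSup_cutoff hν hs]
  congr 1
  ext n
  have := isFiniteMeasure_withDensity_cutoff hfin n
  refine congrArg (fun m : Measure ℝ => m s)
    (ext_of_forall_lintegral_eq_of_IsFiniteMeasure fun f => ?_)
  rw [lintegral_withDensity_cutoff, lintegral_withDensity_cutoff,
    h _ (cutoff_mul_boundedContinuous n f)]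

/-- A family of measures on `ℝ \ {0}` is measurable if the integrals of test functions are. -/
theorem measurable_of_lintegral_testFunction {Ω : Type*} [MeasurableSpace Ω] {κ : Ω → Measure ℝ}
    (h0 : ∀ ω, κ ω {0} = 0)
    (hfin : ∀ ω g, IsTestFunction g → ∫⁻ x, ENNReal.ofReal (g x) ∂κ ω ≠ ∞)
    (h : ∀ g, IsTestFunction g → Measurable fun ω => ∫⁻ x, ENNReal.ofReal (g x) ∂κ ω) :
    Measurable κ := by
  refine Measure.measurable_of_measurable_coe _ fun s hs => ?_
  simp_rw [fun ω => measure_eq_iSup_cutoff (h0 ω) hs]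
  refine Measurable.iSup fun n => ?_
  have := fun ω => isFiniteMeasure_withDensity_cutoff (hfin ω) n
  -- Closed sets form a generating π-system, and their indicators are limits of bounded continuous
  -- functions; times a cutoff, these are test functions.
  have hclosed : ∀ F : Set ℝ, IsClosed F → Measurable fun ω =>
      ((κ ω).withDensity fun x => ENNReal.ofReal (cutoff n x)) F := fun F hF => by
    refine measurable_of_tendsto_metrizable' atTop (f := fun m ω =>
      ∫⁻ x, hF.apprSeq m x ∂((κ ω).withDensity fun x => ENNReal.ofReal (cutoff n x)))
      (fun m => ?_) (tendsto_pi_nhds.2 fun ω =>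
        HasOuterApproxClosed.tendsto_lintegral_apprSeq hF _)
    simp_rw [lintegral_withDensity_cutoff]
    exact h _ (cutoff_mul_boundedContinuous n _)
  have hm : Measurable fun ω => (κ ω).withDensity fun x => ENNReal.ofReal (cutoff n x) :=
    Measurable.measure_of_isPiSystem
      (by rw [BorelSpace.measurable_eq (α := ℝ), borel_eq_generateFrom_isClosed])
      isPiSystem_isClosed hclosed (hclosed _ isClosed_univ)
  exact (Measure.measurable_coe hs).comp hm

end Cutoff

/-! ### A measurable jump kernel, and Campbell's formulas for measurable functions. -/

section Kernel

variable {Ω : Type*} [MeasurableSpace Ω] {P : Measure Ω} {X : ℝ≥0 → Ω → ℝ} {p : ℝ → ℝ}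

theorem jumpSizes_zero (T : ℝ≥0) (f : ℝ≥0 → ℝ) : jumpSizes T f {0} = 0 := by
  rw [← lintegral_indicator_one (measurableSet_singleton (0 : ℝ)),
    lintegral_jumpSizes T f (measurable_one.indicator (measurableSet_singleton (0 : ℝ)))]
  refine ENNReal.tsum_eq_zero.2 fun t => ?_
  have ht : jump f t ∉ ({0} : Set ℝ) := t.2.2
  rw [indicator_apply_eq_zero]
  exact fun _ => indicator_of_notMem ht _

/-- Up to a null set, the jump sizes of a Lévy process form a measurable family of measures. -/
theorem IsLevyProcess.exists_jumpKernel (hX : IsLevyProcess P X p) (T : ℝ≥0) :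
    ∃ κ : Ω → Measure ℝ, Measurable κ ∧ (∀ ω, κ ω {0} = 0) ∧
      (∀ ω g, IsTestFunction g → ∫⁻ x, ENNReal.ofReal (g x) ∂κ ω ≠ ∞) ∧
      ∀ᵐ ω ∂P, jumpSizes T (fun t => X t ω) = κ ω := by
  classical
  -- The set of càdlàg paths need not be measurable. It is replaced by a measurable subset of full
  -- measure, outside which the kernel is set to `0`.
  obtain ⟨G, hG, hGm, hGc⟩ : ∃ G : Set Ω, (∀ ω ∈ G, IsCadlag fun t => X t ω) ∧ MeasurableSet G ∧
      ∀ᵐ ω ∂P, ω ∈ G := by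
    obtain ⟨N, hN, hNm, hN0⟩ := exists_measurable_superset_of_null (ae_iff.1 hX.cadlag)
    refine ⟨Nᶜ, fun ω hω => ?_, hNm.compl, ?_⟩
    · by_contra h
      exact hω (hN h)
    · rw [ae_iff]
      simpa using hN0
  have hlim : ∀ ω ∈ G, ∀ g, IsTestFunction g →
      ∫⁻ x, ENNReal.ofReal (g x) ∂jumpSizes T (fun t => X t ω) ≠ ∞ ∧
      Tendsto (incrementSum g T fun t => X t ω) atTop
        (𝓝 (∫⁻ x, ENNReal.ofReal (g x) ∂jumpSizes T fun t => X t ω).toReal) := by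
    intro ω hω g hg
    obtain ⟨ε, hε, hgε⟩ := hg.vanish
    exact (hG ω hω).tendsto_incrementSum_lintegral T hg.continuous hg.nonneg hε hgε
  let κ : Ω → Measure ℝ := fun ω => if ω ∈ G then jumpSizes T (fun t => X t ω) else 0
  have h0 : ∀ ω, κ ω {0} = 0 := fun ω => by
    by_cases hω : ω ∈ G
    · simp only [κ, hω, if_true, jumpSizes_zero]
    · simp [κ, hω]
  have hfin : ∀ ω g, IsTestFunction g → ∫⁻ x, ENNReal.ofReal (g x) ∂κ ω ≠ ∞ := fun ω g hg => by
    by_cases hω : ω ∈ G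
    · simpa only [κ, hω, if_true] using (hlim ω hω g hg).1
    · simp [κ, hω]
  refine ⟨κ, measurable_of_lintegral_testFunction h0 hfin fun g hg => ?_, h0, hfin, ?_⟩
  · refine measurable_of_tendsto_metrizable' atTop (f := fun n ω =>
      G.indicator (fun ω => ENNReal.ofReal (incrementSum g T (fun t => X t ω) n)) ω)
      (fun n => (hX.measurable_incrementSum T hg.continuous n).ennreal_ofReal.indicator hGm)
      (tendsto_pi_nhds.2 fun ω => ?_)
    by_cases hω : ω ∈ G
    · have h := ENNReal.tendsto_ofReal (hlim ω hω g hg).2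
      rw [ENNReal.ofReal_toReal (hlim ω hω g hg).1] at h
      simpa only [κ, hω, if_true, indicator_of_mem] using h
    · simp [κ, hω]
  · filter_upwards [hGc] with ω hω
    simp [κ, hω]

theorem IsLevyDensity.integrable_testFunction (hp : IsLevyDensity p) {g : ℝ → ℝ}
    (hg : IsTestFunction g) : Integrable g (levyMeasure p) := by
  obtain ⟨M, hM⟩ := hg.bounded
  obtain ⟨ε, hε, hgε⟩ := hg.vanish
  have hm : 0 < min 1 (ε ^ 2) := lt_min one_pos (by positivity)
  have hM0 : 0 ≤ M := (hg.nonneg 0).trans (hM 0)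
  refine hp.integrable_of_norm_le hg.continuous.aestronglyMeasurable (M / min 1 (ε ^ 2))
    fun x => ?_
  rw [Real.norm_of_nonneg (hg.nonneg x)]
  rcases lt_or_ge |x| ε with hx | hx
  · rw [hgε x hx]
    positivity
  · refine (hM x).trans ?_
    rw [div_mul_eq_mul_div, le_div_iff₀ hm]
    have : ε ^ 2 ≤ x ^ 2 := by
      rw [← sq_abs x]
      gcongr
    gcongr

theorem IsLevyDensity.ofReal_integral_testFunction (hp : IsLevyDensity p) {g : ℝ → ℝ}
    (hg : IsTestFunction g) :
    ENNReal.ofReal (∫ x, g x ∂levyMeasure p) = ∫⁻ x, ENNReal.ofReal (g x) ∂levyMeasure p :=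
  ofReal_integral_eq_lintegral_ofReal (hp.integrable_testFunction hg)
    (Eventually.of_forall hg.nonneg)

variable {T : ℝ≥0} {κ : Ω → Measure ℝ}

theorem lintegral_bind_withDensity (hκ : Measurable κ) {S : Ω → ℝ≥0∞} (hS : Measurable S)
    {g : ℝ → ℝ≥0∞} (hg : Measurable g) :
    ∫⁻ x, g x ∂(P.withDensity S).bind κ = ∫⁻ ω, S ω * ∫⁻ x, g x ∂κ ω ∂P := by
  have hm : Measurable fun ω => ∫⁻ x, g x ∂κ ω := (Measure.measurable_lintegral hg).comp hκ
  rw [Measure.lintegral_bind hκ.aemeasurable hg.aemeasurable,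
    lintegral_withDensity_eq_lintegral_mul _ hS hm]
  rfl

theorem lintegral_second_moment (c : ℝ≥0) (ν : Measure ℝ) {f g : ℝ → ℝ≥0∞} (hf : Measurable f)
    (hg : Measurable g) :
    ∫⁻ x, g x ∂((c : ℝ≥0∞) • ν.withDensity f + ((c : ℝ≥0∞) * ∫⁻ x, f x ∂ν) • ((c : ℝ≥0∞) • ν)) =
      c * ∫⁻ x, f x * g x ∂ν + (c * ∫⁻ x, f x ∂ν) * (c * ∫⁻ x, g x ∂ν) := by
  rw [lintegral_add_measure, lintegral_smul_measure, lintegral_smul_measure,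
    lintegral_smul_measure, lintegral_withDensity_eq_lintegral_mul _ hf hg]
  rfl

/-- A kernel satisfying the second order Campbell formula for test functions satisfies it
for all measurable functions. -/
theorem lintegral_mul_of_testFunction {ν : Measure ℝ} (hν : ν {0} = 0) (hκ : Measurable κ)
    (hκ0 : ∀ ω, κ ω {0} = 0) {f : ℝ → ℝ≥0∞} (hf : Measurable f)
    (hfin : ∀ g, IsTestFunction g →
      ∫⁻ ω, (∫⁻ x, f x ∂κ ω) * ∫⁻ x, ENNReal.ofReal (g x) ∂κ ω ∂P ≠ ∞)
    (h : ∀ g, IsTestFunction g → ∫⁻ ω, (∫⁻ x, f x ∂κ ω) * ∫⁻ x, ENNReal.ofReal (g x) ∂κ ω ∂P =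
      T * ∫⁻ x, f x * ENNReal.ofReal (g x) ∂ν +
        (T * ∫⁻ x, f x ∂ν) * (T * ∫⁻ x, ENNReal.ofReal (g x) ∂ν))
    {g : ℝ → ℝ≥0∞} (hg : Measurable g) :
    ∫⁻ ω, (∫⁻ x, f x ∂κ ω) * ∫⁻ x, g x ∂κ ω ∂P =
      T * ∫⁻ x, f x * g x ∂ν + (T * ∫⁻ x, f x ∂ν) * (T * ∫⁻ x, g x ∂ν) := by
  have hS : Measurable fun ω => ∫⁻ x, f x ∂κ ω := (Measure.measurable_lintegral hf).comp hκ
  -- For fixed `f`, both sides of the formula are integrals of `g` against a measure: on the left,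
  -- `κ` averaged under `P` with the weight `∫ f dκ`. Test functions suffice to identify the two
  -- measures.
  have hext : (P.withDensity fun ω => ∫⁻ x, f x ∂κ ω).bind κ =
      (T : ℝ≥0∞) • ν.withDensity f + ((T : ℝ≥0∞) * ∫⁻ x, f x ∂ν) • ((T : ℝ≥0∞) • ν) := by
    refine ext_of_lintegral_testFunction ?_ ?_ (fun g hg => ?_) fun g hg => ?_
    · rw [Measure.bind_apply (measurableSet_singleton 0) hκ.aemeasurable]
      simp [hκ0]
    · simp [withDensity_absolutelyContinuous _ _ hν, hν]
    · rw [lintegral_bind_withDensity hκ hS hg.continuous.measurable.ennreal_ofReal]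
      exact hfin g hg
    · rw [lintegral_bind_withDensity hκ hS hg.continuous.measurable.ennreal_ofReal,
        lintegral_second_moment T ν hf hg.continuous.measurable.ennreal_ofReal, h g hg]
  rw [← lintegral_bind_withDensity hκ hS hg, hext, lintegral_second_moment T ν hf hg]

variable [IsProbabilityMeasure P]

/-- Campbell's formula. -/
theorem IsLevyProcess.bind_jumpKernel (hX : IsLevyProcess P X p) (hκ : Measurable κ)
    (hκ0 : ∀ ω, κ ω {0} = 0)
    (hfin : ∀ ω g, IsTestFunction g → ∫⁻ x, ENNReal.ofReal (g x) ∂κ ω ≠ ∞)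
    (hκX : ∀ᵐ ω ∂P, jumpSizes T (fun t => X t ω) = κ ω) :
    P.bind κ = T • levyMeasure p := by
  have hval : ∀ g, IsTestFunction g →
      ∫⁻ x, ENNReal.ofReal (g x) ∂P.bind κ = T * ∫⁻ x, ENNReal.ofReal (g x) ∂levyMeasure p := by
    intro g hg
    have hgm : Measurable fun x => ENNReal.ofReal (g x) := hg.continuous.measurable.ennreal_ofReal
    obtain ⟨h1, h2⟩ := hX.integral_jumpSizes T hg
    rw [Measure.lintegral_bind hκ.aemeasurable hgm.aemeasurable,
      ← hX.levyDensity.ofReal_integral_testFunction hg, ← ENNReal.ofReal_coe_nnreal,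
      ← ENNReal.ofReal_mul T.coe_nonneg, ← h2,
      ofReal_integral_eq_lintegral_ofReal h1 (Eventually.of_forall fun _ => ENNReal.toReal_nonneg)]
    refine lintegral_congr_ae ?_
    filter_upwards [hκX] with ω hω
    rw [hω, ENNReal.ofReal_toReal (hfin ω g hg)]
  refine ext_of_lintegral_testFunction ?_ ?_ (fun g hg => ?_) fun g hg => ?_
  · rw [Measure.bind_apply (measurableSet_singleton 0) hκ.aemeasurable]
    simp [hκ0]
  · simp [levyMeasure_zero]
  · rw [hval g hg, ← hX.levyDensity.ofReal_integral_testFunction hg]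
    exact ENNReal.mul_ne_top ENNReal.coe_ne_top ENNReal.ofReal_ne_top
  · rw [hval g hg, lintegral_smul_measure]
    rfl

/-- The second order Campbell formula. -/
theorem IsLevyProcess.lintegral_mul_jumpKernel (hX : IsLevyProcess P X p) (hκ : Measurable κ)
    (hκ0 : ∀ ω, κ ω {0} = 0)
    (hfin : ∀ ω g, IsTestFunction g → ∫⁻ x, ENNReal.ofReal (g x) ∂κ ω ≠ ∞)
    (hκX : ∀ᵐ ω ∂P, jumpSizes T (fun t => X t ω) = κ ω) {f g : ℝ → ℝ≥0∞} (hf : Measurable f)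
    (hg : Measurable g) (hfi : ∫⁻ x, f x ∂levyMeasure p ≠ ∞) :
    ∫⁻ ω, (∫⁻ x, f x ∂κ ω) * ∫⁻ x, g x ∂κ ω ∂P = T * ∫⁻ x, f x * g x ∂levyMeasure p +
      (T * ∫⁻ x, f x ∂levyMeasure p) * (T * ∫⁻ x, g x ∂levyMeasure p) := by
  set ν := levyMeasure p with hνdef
  have hν : ν {0} = 0 := levyMeasure_zero
  have hp := hX.levyDensity
  have hT : (T : ℝ≥0∞) = ENNReal.ofReal T := ENNReal.ofReal_coe_nnreal.symm
  have htt : ∀ f g, IsTestFunction f → IsTestFunction g →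
      ∫⁻ ω, (∫⁻ x, ENNReal.ofReal (f x) ∂κ ω) * ∫⁻ x, ENNReal.ofReal (g x) ∂κ ω ∂P =
      T * ∫⁻ x, ENNReal.ofReal (f x) * ENNReal.ofReal (g x) ∂ν +
        (T * ∫⁻ x, ENNReal.ofReal (f x) ∂ν) * (T * ∫⁻ x, ENNReal.ofReal (g x) ∂ν) := by
    intro f g hf hg
    obtain ⟨h1, h2⟩ := hX.integral_jumpSizes_mul T hf hg
    have hfi : 0 ≤ ∫ x, f x ∂ν := integral_nonneg hf.nonneg
    have hgi : 0 ≤ ∫ x, g x ∂ν := integral_nonneg hg.nonneg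
    have hfgi : 0 ≤ ∫ x, f x * g x ∂ν := integral_nonneg (hf.mul hg).nonneg
    simp_rw [← ENNReal.ofReal_mul (hf.nonneg _)]
    rw [← hp.ofReal_integral_testFunction hf, ← hp.ofReal_integral_testFunction hg,
      ← hp.ofReal_integral_testFunction (hf.mul hg), hT, ← ENNReal.ofReal_mul T.coe_nonneg,
      ← ENNReal.ofReal_mul T.coe_nonneg, ← ENNReal.ofReal_mul T.coe_nonneg,
      ← ENNReal.ofReal_mul (by positivity), ← ENNReal.ofReal_add (by positivity) (by positivity),
      ← h2, ofReal_integral_eq_lintegral_ofReal h1 (Eventually.of_forall fun _ =>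
        mul_nonneg ENNReal.toReal_nonneg ENNReal.toReal_nonneg)]
    refine lintegral_congr_ae ?_
    filter_upwards [hκX] with ω hω
    rw [hω, ENNReal.ofReal_mul ENNReal.toReal_nonneg, ENNReal.ofReal_toReal (hfin ω f hf),
      ENNReal.ofReal_toReal (hfin ω g hg)]
  have hntop : ∀ g, IsTestFunction g → ∫⁻ x, ENNReal.ofReal (g x) ∂ν ≠ ∞ := fun g hg => by
    rw [← hp.ofReal_integral_testFunction hg]
    exact ENNReal.ofReal_ne_top
  have htt_top : ∀ f g, IsTestFunction f → IsTestFunction g →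
      ∫⁻ ω, (∫⁻ x, ENNReal.ofReal (f x) ∂κ ω) * ∫⁻ x, ENNReal.ofReal (g x) ∂κ ω ∂P ≠ ∞ := by
    intro f g hf hg
    have hfg := hntop _ (hf.mul hg)
    simp_rw [ENNReal.ofReal_mul (hf.nonneg _)] at hfg
    rw [htt f g hf hg]
    exact ENNReal.add_ne_top.2 ⟨ENNReal.mul_ne_top ENNReal.coe_ne_top hfg,
      ENNReal.mul_ne_top (ENNReal.mul_ne_top ENNReal.coe_ne_top (hntop f hf))
        (ENNReal.mul_ne_top ENNReal.coe_ne_top (hntop g hg))⟩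
  -- First extension, in the second argument; symmetry of the formula then frees the first argument.
  have htm : ∀ f, IsTestFunction f → ∀ g : ℝ → ℝ≥0∞, Measurable g →
      ∫⁻ ω, (∫⁻ x, ENNReal.ofReal (f x) ∂κ ω) * ∫⁻ x, g x ∂κ ω ∂P =
      T * ∫⁻ x, ENNReal.ofReal (f x) * g x ∂ν +
        (T * ∫⁻ x, ENNReal.ofReal (f x) ∂ν) * (T * ∫⁻ x, g x ∂ν) := fun f hf g hg =>
    lintegral_mul_of_testFunction hν hκ hκ0 hf.continuous.measurable.ennreal_ofReal
      (fun g hg => htt_top f g hf hg) (fun g hg => htt f g hf hg) hg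
  have hmt : ∀ g, IsTestFunction g →
      ∫⁻ ω, (∫⁻ x, f x ∂κ ω) * ∫⁻ x, ENNReal.ofReal (g x) ∂κ ω ∂P =
      T * ∫⁻ x, f x * ENNReal.ofReal (g x) ∂ν +
        (T * ∫⁻ x, f x ∂ν) * (T * ∫⁻ x, ENNReal.ofReal (g x) ∂ν) := fun g hg => by
    simpa only [mul_comm] using htm g hg f hf
  -- Second extension, now with `f` only measurable. The finiteness it requires follows from `∫ f dν
  -- < ∞`, because the test function `g` is bounded.
  refine lintegral_mul_of_testFunction hν hκ hκ0 hf (fun g hg => ?_) hmt hg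
  obtain ⟨M, hM⟩ := hg.bounded
  have hfg : ∫⁻ x, f x * ENNReal.ofReal (g x) ∂ν ≠ ∞ := by
    refine ne_top_of_le_ne_top (ENNReal.mul_ne_top hfi (ENNReal.ofReal_ne_top (r := M))) ?_
    rw [← lintegral_mul_const _ hf]
    refine lintegral_mono fun x => ?_
    gcongr
    exact hM x
  rw [hmt g hg]
  exact ENNReal.add_ne_top.2 ⟨ENNReal.mul_ne_top ENNReal.coe_ne_top hfg,
    ENNReal.mul_ne_top (ENNReal.mul_ne_top ENNReal.coe_ne_top hfi)
      (ENNReal.mul_ne_top ENNReal.coe_ne_top (hntop g hg))⟩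

end Kernel

/-! ### First two moments of integrals against the jump measure. -/

section Moments

theorem integral_sub_add {α : Type*} [MeasurableSpace α] {μ : Measure α} {a b c : α → ℝ}
    (ha : Integrable a μ) (hb : Integrable b μ) (hc : Integrable c μ) :
    ∫ x, (a x - b x + c x) ∂μ = ∫ x, a x ∂μ - ∫ x, b x ∂μ + ∫ x, c x ∂μ := by
  have hab : Integrable (fun x => a x - b x) μ := ha.sub hb
  rw [integral_add hab hc, integral_sub ha hb]

theorem integrable_mul_of_memLp_two {α : Type*} [MeasurableSpace α] {μ : Measure α} {f g : α → ℝ}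
    (hf : MemLp f 2 μ) (hg : MemLp g 2 μ) : Integrable (fun x => f x * g x) μ :=
  hf.integrable_mul hg

theorem integral_toReal_mul_toReal {Ω : Type*} [MeasurableSpace Ω] {P : Measure Ω}
    {a b : Ω → ℝ≥0∞} (ha : Measurable a) (hb : Measurable b) (h : ∫⁻ ω, a ω * b ω ∂P ≠ ∞) :
    Integrable (fun ω => (a ω).toReal * (b ω).toReal) P ∧
      ∫ ω, (a ω).toReal * (b ω).toReal ∂P = (∫⁻ ω, a ω * b ω ∂P).toReal := by
  simp_rw [← ENNReal.toReal_mul]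
  exact ⟨integrable_toReal_of_lintegral_ne_top (ha.mul hb).aemeasurable h,
    integral_toReal (ha.mul hb).aemeasurable (ae_lt_top (ha.mul hb) h)⟩

variable {Ω : Type*} [MeasurableSpace Ω] {P : Measure Ω} {κ : Ω → Measure ℝ} {ν : Measure ℝ}
  {T : ℝ≥0}

/-- Mean and second moment of an integral against a random measure satisfying the first and second
order Campbell formulas of a Poisson random measure. -/
theorem moments_of_campbell (hκ : Measurable κ) (h1 : P.bind κ = T • ν)
    (h2 : ∀ f g : ℝ → ℝ≥0∞, Measurable f → Measurable g → ∫⁻ x, f x ∂ν ≠ ∞ →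
      ∫⁻ ω, (∫⁻ x, f x ∂κ ω) * ∫⁻ x, g x ∂κ ω ∂P =
        T * ∫⁻ x, f x * g x ∂ν + (T * ∫⁻ x, f x ∂ν) * (T * ∫⁻ x, g x ∂ν))
    {g : ℝ → ℝ} (hg : Measurable g) (hgi : Integrable g ν)
    (hg2 : Integrable (fun x => g x ^ 2) ν) :
    (∀ᵐ ω ∂P, Integrable g (κ ω)) ∧
    (Integrable (fun ω => ∫ x, g x ∂κ ω) P ∧ ∫ ω, ∫ x, g x ∂κ ω ∂P = T * ∫ x, g x ∂ν) ∧
    (Integrable (fun ω => (∫ x, g x ∂κ ω) ^ 2) P ∧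
      ∫ ω, (∫ x, g x ∂κ ω) ^ 2 ∂P = T * ∫ x, g x ^ 2 ∂ν + (T * ∫ x, g x ∂ν) ^ 2) := by
  have hmean : ∀ f : ℝ → ℝ≥0∞, Measurable f →
      ∫⁻ ω, ∫⁻ x, f x ∂κ ω ∂P = T * ∫⁻ x, f x ∂ν := fun f hf => by
    rw [← Measure.lintegral_bind hκ.aemeasurable hf.aemeasurable, h1, lintegral_smul_measure]
    rfl
  have hmeas : ∀ f : ℝ → ℝ≥0∞, Measurable f → Measurable fun ω => ∫⁻ x, f x ∂κ ω :=
    fun f hf => (Measure.measurable_lintegral hf).comp hκ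
  let gp : ℝ → ℝ≥0∞ := fun x => ENNReal.ofReal (g x)
  let gm : ℝ → ℝ≥0∞ := fun x => ENNReal.ofReal (-g x)
  have hgp : Measurable gp := hg.ennreal_ofReal
  have hgm : Measurable gm := hg.neg.ennreal_ofReal
  have hpi : ∫⁻ x, gp x ∂ν ≠ ∞ := hgi.lintegral_lt_top.ne
  have hmi : ∫⁻ x, gm x ∂ν ≠ ∞ := hgi.neg.lintegral_lt_top.ne
  have hsplit : ∀ x, ENNReal.ofReal (g x ^ 2) = gp x * gp x + gm x * gm x := fun x => by
    rcases le_total 0 (g x) with h | h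
    · have : gm x = 0 := ENNReal.ofReal_of_nonpos (by linarith)
      simp only [this, gp, ← ENNReal.ofReal_mul h, mul_zero, add_zero, sq]
    · have : gp x = 0 := ENNReal.ofReal_of_nonpos h
      simp only [this, gm, ← ENNReal.ofReal_mul (neg_nonneg.2 h), mul_zero, zero_add, sq,
        neg_mul_neg]
  -- Disjoint supports remove the diagonal term from the mixed moment of the positive and negative
  -- parts.
  have hcross : ∀ x, gp x * gm x = 0 := fun x => by
    rcases le_total 0 (g x) with h | h
    · have : gm x = 0 := ENNReal.ofReal_of_nonpos (by linarith)
      simp [this]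
    · have : gp x = 0 := ENNReal.ofReal_of_nonpos h
      simp [this]
  have hsq : ∫⁻ x, gp x * gp x ∂ν + ∫⁻ x, gm x * gm x ∂ν = ∫⁻ x, ENNReal.ofReal (g x ^ 2) ∂ν := by
    have hm : Measurable fun x => gp x * gp x := hgp.mul hgp
    rw [← lintegral_add_left hm]
    exact lintegral_congr fun x => (hsplit x).symm
  have hsq_ne : ∫⁻ x, gp x * gp x ∂ν + ∫⁻ x, gm x * gm x ∂ν ≠ ∞ := by
    rw [hsq]
    exact hg2.lintegral_lt_top.ne
  obtain ⟨hpp, hmm⟩ := ENNReal.add_ne_top.1 hsq_ne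
  have hTp : (T : ℝ≥0∞) * ∫⁻ x, gp x ∂ν ≠ ∞ := ENNReal.mul_ne_top ENNReal.coe_ne_top hpi
  have hTm : (T : ℝ≥0∞) * ∫⁻ x, gm x ∂ν ≠ ∞ := ENNReal.mul_ne_top ENNReal.coe_ne_top hmi
  have hTpp : (T : ℝ≥0∞) * ∫⁻ x, gp x * gp x ∂ν ≠ ∞ := ENNReal.mul_ne_top ENNReal.coe_ne_top hpp
  have hTmm : (T : ℝ≥0∞) * ∫⁻ x, gm x * gm x ∂ν ≠ ∞ := ENNReal.mul_ne_top ENNReal.coe_ne_top hmm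
  have hEp := hmean gp hgp
  have hEm := hmean gm hgm
  have hEpp := h2 gp gp hgp hgp hpi
  have hEmm := h2 gm gm hgm hgm hmi
  have hEpm := h2 gp gm hgp hgm hpi
  simp only [hcross, lintegral_zero, mul_zero, zero_add] at hEpm
  have hae : ∀ᵐ ω ∂P, Integrable g (κ ω) := by
    filter_upwards [ae_lt_top (hmeas gp hgp) (hEp ▸ hTp), ae_lt_top (hmeas gm hgm) (hEm ▸ hTm)]
      with ω hω1 hω2
    refine ⟨hg.aestronglyMeasurable, ?_⟩
    have habs : ∀ x, ‖g x‖ₑ = gp x + gm x := fun x => by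
      rw [Real.enorm_eq_ofReal_abs]
      rcases le_total 0 (g x) with h | h
      · have : gm x = 0 := ENNReal.ofReal_of_nonpos (by linarith)
        rw [abs_of_nonneg h, this, add_zero]
      · have : gp x = 0 := ENNReal.ofReal_of_nonpos h
        rw [abs_of_nonpos h, this, zero_add]
    rw [HasFiniteIntegral]
    simp_rw [habs]
    rw [lintegral_add_left hgp]
    exact ENNReal.add_lt_top.2 ⟨hω1, hω2⟩
  have heq : (fun ω => ∫ x, g x ∂κ ω) =ᵐ[P]
      fun ω => (∫⁻ x, gp x ∂κ ω).toReal - (∫⁻ x, gm x ∂κ ω).toReal := by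
    filter_upwards [hae] with ω hω
    exact integral_eq_lintegral_pos_part_sub_lintegral_neg_part hω
  have heq2 : (fun ω => (∫ x, g x ∂κ ω) ^ 2) =ᵐ[P]
      fun ω => (∫⁻ x, gp x ∂κ ω).toReal * (∫⁻ x, gp x ∂κ ω).toReal -
        2 * ((∫⁻ x, gp x ∂κ ω).toReal * (∫⁻ x, gm x ∂κ ω).toReal) +
        (∫⁻ x, gm x ∂κ ω).toReal * (∫⁻ x, gm x ∂κ ω).toReal := by
    filter_upwards [heq] with ω hω
    rw [hω]
    ring
  have hIp := integrable_toReal_of_lintegral_ne_top (hmeas gp hgp).aemeasurable (hEp ▸ hTp)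
  have hIm := integrable_toReal_of_lintegral_ne_top (hmeas gm hgm).aemeasurable (hEm ▸ hTm)
  have hVp := integral_toReal (hmeas gp hgp).aemeasurable
    (ae_lt_top (hmeas gp hgp) (hEp ▸ hTp))
  have hVm := integral_toReal (hmeas gm hgm).aemeasurable
    (ae_lt_top (hmeas gm hgm) (hEm ▸ hTm))
  obtain ⟨hIpp, hVpp⟩ := integral_toReal_mul_toReal (P := P) (hmeas gp hgp) (hmeas gp hgp)
    (hEpp ▸ ENNReal.add_ne_top.2 ⟨hTpp, ENNReal.mul_ne_top hTp hTp⟩)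
  obtain ⟨hImm, hVmm⟩ := integral_toReal_mul_toReal (P := P) (hmeas gm hgm) (hmeas gm hgm)
    (hEmm ▸ ENNReal.add_ne_top.2 ⟨hTmm, ENNReal.mul_ne_top hTm hTm⟩)
  obtain ⟨hIpm, hVpm⟩ := integral_toReal_mul_toReal (P := P) (hmeas gp hgp) (hmeas gm hgm)
    (hEpm ▸ ENNReal.mul_ne_top hTp hTm)
  have hνint : ∫ x, g x ∂ν = (∫⁻ x, gp x ∂ν).toReal - (∫⁻ x, gm x ∂ν).toReal :=
    integral_eq_lintegral_pos_part_sub_lintegral_neg_part hgi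
  have hνsq : ∫ x, g x ^ 2 ∂ν =
      (∫⁻ x, gp x * gp x ∂ν).toReal + (∫⁻ x, gm x * gm x ∂ν).toReal := by
    rw [integral_eq_lintegral_of_nonneg_ae (Eventually.of_forall fun x => sq_nonneg _)
      hg2.aestronglyMeasurable, ← hsq, ENNReal.toReal_add hpp hmm]
  refine ⟨hae, ⟨(hIp.sub hIm).congr heq.symm, ?_⟩,
    (((hIpp.sub (hIpm.const_mul 2)).add hImm).congr heq2.symm), ?_⟩
  · rw [integral_congr_ae heq, integral_sub hIp hIm, hVp, hVm, hEp, hEm, hνint,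
      ENNReal.toReal_mul, ENNReal.toReal_mul, ENNReal.coe_toReal]
    ring
  · rw [integral_congr_ae heq2, integral_sub_add hIpp (hIpm.const_mul 2) hImm,
      integral_const_mul, hVpp, hVmm, hVpm, hEpp, hEmm, hEpm,
      ENNReal.toReal_add hTpp (ENNReal.mul_ne_top hTp hTp),
      ENNReal.toReal_add hTmm (ENNReal.mul_ne_top hTm hTm), hνint, hνsq]
    simp only [ENNReal.toReal_mul, ENNReal.coe_toReal]
    ring

variable {X : ℝ≥0 → Ω → ℝ} {p : ℝ → ℝ}

theorem map_snd_restrict_jumpMeasure (T : ℝ≥0) (f : ℝ≥0 → ℝ) {D : Set ℝ} (hD : MeasurableSet D) :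
    ((jumpMeasure f).restrict (Icc 0 T ×ˢ D)).map Prod.snd = (jumpSizes T f).restrict D := by
  rw [jumpSizes, Measure.restrict_map measurable_snd hD,
    Measure.restrict_restrict (measurable_snd hD)]
  congr 2
  ext z
  simp [and_comm]

/-- Mean and second moment of the integral of `g` over the jumps of a Lévy process in `D`. -/
theorem IsLevyProcess.moments_integral_jumpMeasure [IsProbabilityMeasure P]
    (hX : IsLevyProcess P X p) (T : ℝ≥0) {D : Set ℝ} (hD : MeasurableSet D) {g : ℝ → ℝ}
    (hgi : Integrable g ((levyMeasure p).restrict D))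
    (hg2 : Integrable (fun x => g x ^ 2) ((levyMeasure p).restrict D)) :
    (∀ᵐ ω ∂P, IntegrableOn (fun z : ℝ≥0 × ℝ => g z.2) (Icc 0 T ×ˢ D)
      (jumpMeasure fun t => X t ω)) ∧
    (Integrable (fun ω => ∫ z in Icc 0 T ×ˢ D, g z.2 ∂jumpMeasure fun t => X t ω) P ∧
      ∫ ω, ∫ z in Icc 0 T ×ˢ D, g z.2 ∂jumpMeasure (fun t => X t ω) ∂P =
        T * ∫ x in D, g x ∂levyMeasure p) ∧
    (Integrable (fun ω => (∫ z in Icc 0 T ×ˢ D, g z.2 ∂jumpMeasure fun t => X t ω) ^ 2) P ∧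
      ∫ ω, (∫ z in Icc 0 T ×ˢ D, g z.2 ∂jumpMeasure (fun t => X t ω)) ^ 2 ∂P =
        T * ∫ x in D, g x ^ 2 ∂levyMeasure p + (T * ∫ x in D, g x ∂levyMeasure p) ^ 2) := by
  obtain ⟨κ, hκ, hκ0, hfin, hκX⟩ := hX.exists_jumpKernel T
  have hbind := hX.bind_jumpKernel hκ hκ0 hfin hκX
  obtain ⟨g', hg'm, hgg'⟩ : ∃ g' : ℝ → ℝ, Measurable g' ∧
      g =ᵐ[(levyMeasure p).restrict D] g' :=
    ⟨hgi.aestronglyMeasurable.mk g, hgi.aestronglyMeasurable.stronglyMeasurable_mk.measurable,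
      hgi.aestronglyMeasurable.ae_eq_mk⟩
  have hi : Integrable (D.indicator g') (levyMeasure p) :=
    (integrable_indicator_iff hD).2 (hgi.congr hgg')
  have hsq : (fun x => D.indicator g' x ^ 2) = D.indicator fun x => g' x ^ 2 := by
    ext x
    by_cases hx : x ∈ D <;> simp [hx]
  have hgg2 : (fun x => g x ^ 2) =ᵐ[(levyMeasure p).restrict D] fun x => g' x ^ 2 := by
    filter_upwards [hgg'] with x hx
    rw [hx]
  have hi2 : Integrable (fun x => D.indicator g' x ^ 2) (levyMeasure p) := by
    rw [hsq]
    exact (integrable_indicator_iff hD).2 (hg2.congr hgg2)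
  obtain ⟨hA, hB, hC⟩ := moments_of_campbell hκ hbind
    (fun f g hf hg hfi => hX.lintegral_mul_jumpKernel hκ hκ0 hfin hκX hf hg hfi)
    (hg'm.indicator hD) hi hi2
  rw [hsq] at hC
  simp only [integral_indicator hD] at hB hC
  -- `g` is measurable only up to a `ν`-null set. By Campbell's formula such a set has mean mass
  -- zero under the kernel, hence almost surely contains no jump sizes, and replacing `g` by `g'` is
  -- harmless.
  have hκae : ∀ᵐ ω ∂P, g =ᵐ[(κ ω).restrict D] g' := by
    obtain ⟨N, hN, hNm, hN0⟩ := exists_measurable_superset_of_null (ae_iff.1 hgg')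
    rw [Measure.restrict_apply hNm] at hN0
    have h0 : ∫⁻ ω, κ ω (N ∩ D) ∂P = 0 := by
      rw [← Measure.bind_apply (hNm.inter hD) hκ.aemeasurable, hbind]
      simp [hN0]
    have hm : Measurable fun ω => κ ω (N ∩ D) := (Measure.measurable_coe (hNm.inter hD)).comp hκ
    rw [lintegral_eq_zero_iff hm] at h0
    filter_upwards [h0] with ω hω
    refine ae_iff.2 (measure_mono_null hN ?_)
    rw [Measure.restrict_apply hNm]
    exact hω
  have hmain : ∀ᵐ ω ∂P, (Integrable (D.indicator g') (κ ω) →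
      IntegrableOn (fun z : ℝ≥0 × ℝ => g z.2) (Icc 0 T ×ˢ D) (jumpMeasure fun t => X t ω)) ∧
      ∫ z in Icc 0 T ×ˢ D, g z.2 ∂jumpMeasure (fun t => X t ω) = ∫ x in D, g' x ∂κ ω := by
    filter_upwards [hκX, hκae] with ω hω hae
    have hmap := map_snd_restrict_jumpMeasure T (fun t => X t ω) hD
    rw [hω] at hmap
    have hsm : AEStronglyMeasurable g
        (((jumpMeasure fun t => X t ω).restrict (Icc 0 T ×ˢ D)).map Prod.snd) := by
      rw [hmap]
      exact ⟨g', hg'm.stronglyMeasurable, hae⟩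
    constructor
    · intro h_int
      have h := (integrable_map_measure hsm measurable_snd.aemeasurable).1 (by
        rw [hmap]
        exact ((integrable_indicator_iff hD).1 h_int).congr hae.symm)
      exact h
    · rw [← integral_map measurable_snd.aemeasurable hsm, hmap]
      exact integral_congr_ae hae
  have heq : (fun ω => ∫ z in Icc 0 T ×ˢ D, g z.2 ∂jumpMeasure fun t => X t ω) =ᵐ[P]
      fun ω => ∫ x in D, g' x ∂κ ω := by
    filter_upwards [hmain] with ω hω using hω.2
  have heq2 : (fun ω => (∫ z in Icc 0 T ×ˢ D, g z.2 ∂jumpMeasure fun t => X t ω) ^ 2) =ᵐ[P]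
      fun ω => (∫ x in D, g' x ∂κ ω) ^ 2 := by
    filter_upwards [heq] with ω hω
    rw [hω]
  refine ⟨?_, ⟨hB.1.congr heq.symm, ?_⟩, hC.1.congr heq2.symm, ?_⟩
  · filter_upwards [hA, hmain] with ω h1 h2 using h2.1 h1
  · rw [integral_congr_ae heq, hB.2, integral_congr_ae hgg']
  · rw [integral_congr_ae heq2, hC.2, integral_congr_ae hgg', integral_congr_ae hgg2]

end Moments

/-! ### The reference density and the Hilbert space geometry of the estimator. -/

section L2

variable {p : ℝ → ℝ} {D : Set ℝ} {η : Measure ℝ} {s : ℝ → ℝ}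

theorem HasReferenceDensity.integrable_iff (hs : HasReferenceDensity p D η s) {g : ℝ → ℝ} :
    Integrable g ((levyMeasure p).restrict D) ↔
      Integrable (fun x => g x * s x) (η.restrict D) := by
  rw [hs.density, integrable_withDensity_ofReal_iff hs.memLp.1.aemeasurable hs.nonneg]
  simp only [smul_eq_mul, mul_comm]

theorem HasReferenceDensity.integral_eq (hs : HasReferenceDensity p D η s) (g : ℝ → ℝ) :
    ∫ x in D, g x ∂levyMeasure p = ∫ x in D, g x * s x ∂η := by
  rw [hs.density, integral_withDensity_ofReal hs.memLp.1.aemeasurable hs.nonneg]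
  simp only [smul_eq_mul, mul_comm]

theorem HasReferenceDensity.integrable (hs : HasReferenceDensity p D η s) {g : ℝ → ℝ}
    (hg : MemLp g 2 (η.restrict D)) : Integrable g ((levyMeasure p).restrict D) :=
  hs.integrable_iff.2 (hg.integrable_mul hs.memLp)

/-- Boundedness of `s` enters here: `g² s ≤ C g²`. For the first moment, Cauchy-Schwarz with `s` in
`L²` was enough. -/
theorem HasReferenceDensity.integrable_sq (hs : HasReferenceDensity p D η s) {g : ℝ → ℝ}
    (hg : MemLp g 2 (η.restrict D)) :
    Integrable (fun x => g x ^ 2) ((levyMeasure p).restrict D) := by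
  obtain ⟨C, hC⟩ := hs.bounded
  rw [hs.integrable_iff]
  simp only [mul_comm _ (s _)]
  refine hg.integrable_sq.bdd_mul hs.memLp.1 (c := C) ?_
  filter_upwards [hC, hs.nonneg] with x h1 h2
  rwa [Real.norm_of_nonneg h2]

/-- Mean and second moment of the empirical coefficients. -/
theorem HasReferenceDensity.moments_empiricalCoeff {Ω : Type*} [MeasurableSpace Ω] {P : Measure Ω}
    [IsProbabilityMeasure P] {X : ℝ≥0 → Ω → ℝ} (hX : IsLevyProcess P X p) (hD : MeasurableSet D)
    (hs : HasReferenceDensity p D η s) {T : ℝ≥0} (hT : 0 < T) {g : ℝ → ℝ}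
    (hg : MemLp g 2 (η.restrict D)) :
    (Integrable (fun ω => empiricalCoeff D T g fun t => X t ω) P ∧
      ∫ ω, empiricalCoeff D T g (fun t => X t ω) ∂P = ∫ x in D, g x * s x ∂η) ∧
    (Integrable (fun ω => (empiricalCoeff D T g (fun t => X t ω) - ∫ x in D, g x * s x ∂η) ^ 2) P ∧
      ∫ ω, (empiricalCoeff D T g (fun t => X t ω) - ∫ x in D, g x * s x ∂η) ^ 2 ∂P =
        (1 / (T : ℝ)) * ∫ x in D, g x ^ 2 * s x ∂η) := by
  obtain ⟨-, ⟨h1, h2⟩, h3, h4⟩ :=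
    hX.moments_integral_jumpMeasure T hD (hs.integrable hg) (hs.integrable_sq hg)
  rw [hs.integral_eq] at h2
  rw [hs.integral_eq, hs.integral_eq] at h4
  have hT' : (T : ℝ) ≠ 0 := by exact_mod_cast hT.ne'
  set m := ∫ x in D, g x * s x ∂η
  have hexp : ∀ ω, (empiricalCoeff D T g (fun t => X t ω) - m) ^ 2 =
      (1 / (T : ℝ)) ^ 2 * (∫ z in Icc 0 T ×ˢ D, g z.2 ∂jumpMeasure fun t => X t ω) ^ 2 -
      2 * m * (1 / (T : ℝ)) * (∫ z in Icc 0 T ×ˢ D, g z.2 ∂jumpMeasure fun t => X t ω) + m ^ 2 :=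
    fun ω => by
      rw [empiricalCoeff]
      ring
  have hi1 := h3.const_mul ((1 / (T : ℝ)) ^ 2)
  have hi2 := h1.const_mul (2 * m * (1 / (T : ℝ)))
  refine ⟨⟨h1.const_mul _, ?_⟩, ?_⟩
  · simp only [empiricalCoeff]
    rw [integral_const_mul, h2]
    field_simp
  -- Centring cancels the square of the mean in the second moment formula, leaving only the diagonal
  -- term `T ∫ g² s dη`, divided by `T²`.
  · simp_rw [hexp]
    refine ⟨(hi1.sub hi2).add (integrable_const _), ?_⟩
    rw [integral_sub_add hi1 hi2 (integrable_const _), integral_const_mul,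
      integral_const_mul, h2, h4, integral_const]
    simp
    field_simp
    ring

variable {d : ℕ} {φ : Fin d → ℝ → ℝ} {S : Submodule ℝ (Lp ℝ 2 (η.restrict D))}

theorem IsOrthonormalBasisOf.memLp (hφ : IsOrthonormalBasisOf φ S) (i : Fin d) :
    MemLp (φ i) 2 (η.restrict D) := by
  obtain ⟨e, he⟩ := hφ
  exact (memLp_congr_ae (he i)).2 (Lp.memLp _)

theorem IsOrthonormalBasisOf.integral_mul (hφ : IsOrthonormalBasisOf φ S) (i j : Fin d) :
    ∫ x in D, φ i x * φ j x ∂η = if i = j then 1 else 0 := by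
  obtain ⟨e, he⟩ := hφ
  rw [← orthonormal_iff_ite.1 e.orthonormal i j, Submodule.coe_inner, L2.inner_def]
  refine integral_congr_ae ?_
  filter_upwards [he i, he j] with x hi hj
  rw [hi, hj]
  simp [mul_comm]

theorem IsOrthonormalBasisOf.projection_ae_eq [FiniteDimensional ℝ S]
    (hφ : IsOrthonormalBasisOf φ S) (hs : MemLp s 2 (η.restrict D)) :
    projection D η φ s =ᵐ[η.restrict D] (S.starProjection (hs.toLp s) : ℝ → ℝ) := by
  obtain ⟨e, he⟩ := hφ
  have hcoef : ∀ i, inner ℝ (e i : Lp ℝ 2 (η.restrict D)) (hs.toLp s) =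
      ∫ y in D, φ i y * s y ∂η := fun i => by
    rw [L2.inner_def]
    refine integral_congr_ae ?_
    filter_upwards [he i, hs.coeFn_toLp] with x h1 h2
    rw [h1, h2]
    simp [mul_comm]
  have hproj : S.starProjection (hs.toLp s) =
      ∑ i, (∫ y in D, φ i y * s y ∂η) • (e i : Lp ℝ 2 (η.restrict D)) := by
    rw [Submodule.starProjection_apply, e.orthogonalProjectionOnto_apply_eq_sum]
    simp [hcoef]
  rw [hproj]
  have hsmul : ∀ᵐ x ∂η.restrict D, ∀ i,
      ((∫ y in D, φ i y * s y ∂η) • (e i : Lp ℝ 2 (η.restrict D)) : Lp ℝ 2 (η.restrict D)) x =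
        (∫ y in D, φ i y * s y ∂η) * φ i x := by
    refine ae_all_iff.2 fun i => ?_
    filter_upwards [he i, Lp.coeFn_smul (∫ y in D, φ i y * s y ∂η)
      (e i : Lp ℝ 2 (η.restrict D))] with x h1 h2
    rw [h2, Pi.smul_apply, smul_eq_mul, h1]
  filter_upwards [hsmul, Lp.coeFn_fun_finsetSum Finset.univ fun i =>
    (∫ y in D, φ i y * s y ∂η) • (e i : Lp ℝ 2 (η.restrict D))] with x h1 h2
  rw [h2, projection]
  exact Finset.sum_congr rfl fun i _ => (h1 i).symm

theorem IsOrthonormalBasisOf.integral_sum_mul (hφ : IsOrthonormalBasisOf φ S) (c : Fin d → ℝ)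
    (j : Fin d) : ∫ x in D, (∑ i, c i * φ i x) * φ j x ∂η = c j := by
  simp_rw [Finset.sum_mul, mul_assoc]
  rw [integral_finsetSum _ fun i _ =>
    (integrable_mul_of_memLp_two (hφ.memLp i) (hφ.memLp j)).const_mul (c i)]
  simp_rw [integral_const_mul, hφ.integral_mul]
  simp

theorem IsOrthonormalBasisOf.memLp_sum (hφ : IsOrthonormalBasisOf φ S) (c : Fin d → ℝ) :
    MemLp (fun x => ∑ i, c i * φ i x) 2 (η.restrict D) :=
  memLp_finsetSum _ fun i _ => (hφ.memLp i).const_mul (c i)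

/-- The pairing of `f` with a linear combination of the basis. -/
theorem IsOrthonormalBasisOf.integral_mul_sum (hφ : IsOrthonormalBasisOf φ S) {f : ℝ → ℝ}
    (hf : MemLp f 2 (η.restrict D)) (c : Fin d → ℝ) :
    ∫ x in D, f x * ∑ i, c i * φ i x ∂η = ∑ i, c i * ∫ x in D, f x * φ i x ∂η := by
  simp_rw [Finset.mul_sum, mul_left_comm _ (c _)]
  rw [integral_finsetSum _ fun i _ =>
    (integrable_mul_of_memLp_two hf (hφ.memLp i)).const_mul (c i)]
  simp_rw [integral_const_mul]

theorem IsOrthonormalBasisOf.normSq_sum (hφ : IsOrthonormalBasisOf φ S) (c : Fin d → ℝ) :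
    normSq D η (fun x => ∑ i, c i * φ i x) = ∑ i, c i ^ 2 := by
  simp_rw [normSq, sq]
  rw [hφ.integral_mul_sum (hφ.memLp_sum c)]
  simp_rw [hφ.integral_sum_mul]

theorem IsOrthonormalBasisOf.chiSq_eq (hφ : IsOrthonormalBasisOf φ S) (T : ℝ≥0) (f : ℝ≥0 → ℝ) :
    chiSq D η T φ s f =
      ∑ i, (empiricalCoeff D T (φ i) f - ∫ x in D, φ i x * s x ∂η) ^ 2 := by
  rw [← hφ.normSq_sum, chiSq]
  simp only [projectionEstimator, projection, ← Finset.sum_sub_distrib, ← sub_mul]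

/-- The Pythagorean decomposition of the loss. -/
theorem IsOrthonormalBasisOf.normSq_sub_projectionEstimator (hφ : IsOrthonormalBasisOf φ S)
    (hs : MemLp s 2 (η.restrict D)) (T : ℝ≥0) (f : ℝ≥0 → ℝ) :
    normSq D η (fun x => s x - projectionEstimator D T φ f x) =
      normSq D η (fun x => s x - projection D η φ s x) + chiSq D η T φ s f := by
  set c : Fin d → ℝ := fun i => empiricalCoeff D T (φ i) f - ∫ x in D, φ i x * s x ∂η with hc
  have hproj : MemLp (projection D η φ s) 2 (η.restrict D) := hφ.memLp_sum _
  have hr : MemLp (fun x => s x - projection D η φ s x) 2 (η.restrict D) := hs.sub hproj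
  have hdiff : ∀ x, projectionEstimator D T φ f x - projection D η φ s x = ∑ i, c i * φ i x :=
    fun x => by
      simp only [projectionEstimator, projection, ← Finset.sum_sub_distrib, ← sub_mul, hc]
  -- The residual `s - s^⊥` has zero inner product with each `φ i`.
  have horth : ∫ x in D, (s x - projection D η φ s x) * ∑ i, c i * φ i x ∂η = 0 := by
    rw [hφ.integral_mul_sum hr]
    refine Finset.sum_eq_zero fun i _ => ?_
    simp_rw [sub_mul]
    rw [integral_sub (integrable_mul_of_memLp_two hs (hφ.memLp i))
      (integrable_mul_of_memLp_two hproj (hφ.memLp i))]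
    have h := hφ.integral_sum_mul (fun i => ∫ y in D, φ i y * s y ∂η) i
    simp only [projection]
    rw [h]
    simp [mul_comm]
  have hexp : ∀ x, (s x - projectionEstimator D T φ f x) ^ 2 =
      (s x - projection D η φ s x) ^ 2 -
        2 * ((s x - projection D η φ s x) * ∑ i, c i * φ i x) + (∑ i, c i * φ i x) ^ 2 := fun x => by
    rw [← hdiff]
    ring
  have h1 := hr.integrable_sq
  have h2 : Integrable (fun x => 2 * ((s x - projection D η φ s x) * ∑ i, c i * φ i x))
      (η.restrict D) := (hr.integrable_mul (hφ.memLp_sum c)).const_mul 2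
  simp only [chiSq, normSq, hdiff, hexp]
  rw [integral_sub_add h1 h2 (hφ.memLp_sum c).integrable_sq, integral_const_mul, horth]
  ring

end L2

end LevyEstimation

/-! ### Assembly of the moment formulas and the Pythagorean identity. -/

theorem proposition2p2 {Ω : Type*} [MeasurableSpace Ω] (P : Measure Ω) [IsProbabilityMeasure P]
    (X : ℝ≥0 → Ω → ℝ) (p : ℝ → ℝ) (hX : IsLevyProcess P X p)
    (D : Set ℝ) (hD : MeasurableSet D) (hD0 : D ⊆ {0}ᶜ)
    (η : Measure ℝ) (s : ℝ → ℝ) (hs : HasReferenceDensity p D η s)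
    (T : ℝ≥0) (hT : 0 < T)
    (S : Submodule ℝ (Lp ℝ 2 (η.restrict D)))
    [FiniteDimensional ℝ S] (d : ℕ) (φ : Fin d → ℝ → ℝ) (hφ : IsOrthonormalBasisOf φ S) :
    -- `s^⊥` is the orthogonal projection of `s` onto `S`
    (projection D η φ s =ᵐ[η.restrict D] (S.starProjection (hs.memLp.toLp s) : ℝ → ℝ)) ∧
    -- the Poisson integrals defining the estimator exist almost surely
    (∀ i, ∀ᵐ ω ∂P, IntegrableOn (fun z : ℝ≥0 × ℝ => φ i z.2) (Icc 0 T ×ˢ D)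
      (jumpMeasure fun t => X t ω)) ∧
    -- unbiasedness
    (∀ x ∈ D, Integrable (fun ω => projectionEstimator D T φ (fun t => X t ω) x) P ∧
      ∫ ω, projectionEstimator D T φ (fun t => X t ω) x ∂P = projection D η φ s x) ∧
    -- mean-square error
    (Integrable (fun ω => chiSq D η T φ s fun t => X t ω) P ∧
      ∫ ω, chiSq D η T φ s (fun t => X t ω) ∂P
        = (1 / (T : ℝ)) * ∑ i, ∫ x in D, φ i x ^ 2 * s x ∂η) ∧
    -- decomposition of the risk
    (Integrable (fun ω => normSq D η fun x =>
        s x - projectionEstimator D T φ (fun t => X t ω) x) P ∧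
      ∫ ω, normSq D η (fun x => s x - projectionEstimator D T φ (fun t => X t ω) x) ∂P
        = normSq D η (fun x => s x - projection D η φ s x)
          + ∫ ω, chiSq D η T φ s (fun t => X t ω) ∂P) := by
  refine ⟨hφ.projection_ae_eq hs.memLp, fun i => ?_, fun x _ => ?_, ?_, ?_⟩
  · exact (hX.moments_integral_jumpMeasure T hD (hs.integrable (hφ.memLp i))
      (hs.integrable_sq (hφ.memLp i))).1
  · have h := fun i => (hs.moments_empiricalCoeff hX hD hT (hφ.memLp i)).1
    simp only [projectionEstimator, projection]
    refine ⟨integrable_finsetSum _ fun i _ => (h i).1.mul_const _, ?_⟩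
    rw [integral_finsetSum _ fun i _ => (h i).1.mul_const _]
    simp_rw [integral_mul_const, fun i => (h i).2]
  · have h := fun i => (hs.moments_empiricalCoeff hX hD hT (hφ.memLp i)).2
    simp_rw [hφ.chiSq_eq]
    refine ⟨integrable_finsetSum _ fun i _ => (h i).1, ?_⟩
    rw [integral_finsetSum _ fun i _ => (h i).1, Finset.mul_sum]
    simp_rw [fun i => (h i).2]
  · have h := fun i => (hs.moments_empiricalCoeff hX hD hT (hφ.memLp i)).2
    have hχ : Integrable (fun ω => chiSq D η T φ s fun t => X t ω) P := by
      simp_rw [hφ.chiSq_eq]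
      exact integrable_finsetSum _ fun i _ => (h i).1
    -- The decomposition holds for every path, with a deterministic first term, so only
    -- integrability of `χ²` is needed to take expectations.
    simp_rw [hφ.normSq_sub_projectionEstimator hs.memLp]
    refine ⟨(integrable_const _).add hχ, ?_⟩
    rw [integral_add (integrable_const _) hχ]
    simp
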